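/- For $f_i:\mathbb{R}^{n_i}\to(-\infty,+\infty]$, matrices $A_i$ and a vector $b\in\mathbb{R}^m$ $(i=1,\dots,N)$, consider the separable problem of minimising $\sum_i f_i(x^i)$ subject to $\sum_i A_ix^i\le b$, with optimal value $p$, and its dual of maximising $-\sum_i f_i^*(-A_i^Ty)-b^Ty$ subject to $y\ge 0$, with optimal value $d$, where $f_i^*$ is the conjugate of $f_i$. The duality gap is $p-d$. Let $N,L\ge 1$ be integers. **Single-path routing.** Consider a network with $N$ users and $L$ links with capacities $c\in\mathbb{R}^L$, $c>0$; put $\|c\|_\infty=\max_l c_l$. User $i$ has $K^i\ge 1$ paths, and its routing matrix $R^i\in\{0,1\}^{L\times K^i}$ has $R^i_{lk}=1$ iff the $k$th path of user $i$ passes through link $l$. Take $A_i=R^i$ and $b=c$. (a) (Throughput utility.) If $f_i(x)=-\max_s x_s$ for $0\le x\le\|c\|_\infty$ and $f_i(x)=+\infty$ otherwise, then $p$ and $d$ are finite and $$p-d\le \min\{N,L\}\,\frac{L}{L+\min\{N,L\}}\,\|c\|_\infty .$$ (b) (Logarithmic utility.) If $f_i(x)=-\log\max_s x_s$ for $0\le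 x\le\|c\|_\infty$, $x\ne 0$, and $f_i(x)=+\infty$ otherwise, then $p$ and $d$ are finite and $$p-d\le \min\{N,L\}\,\log\Bigl(1+\frac{L}{\min\{N,L\}}\Bigr).$$ If moreover every path passes through at least one link, then in both cases $-p$ is the optimal value of the network utility maximisation problem: maximise $\sum_i U(x^i)$ subject to $\sum_iR^ix^i\le c$ and $x^i\ge0$ for all $i$, where $U(x)=\max_s x_s$, respectively $U(x)=\log\max_s x_s$ (with $\log 0=-\infty$). **Dynamic spectrum management.** Let $L$ users share $N$ tones with noises $0<\sigma_i\le 1$ $(i=1,\dots,N)$, $\sigma=\min_i\sigma_i$, and let the power budgets be $0\le p_l\le 1$ $(l=1,\dots,L)$. For a power vector $x^i\in\mathbb{R}^L$ on tone $i$, the rate of user $l$ is $u^i_l(x^i)=\frac1N\log\bigl(1+\frac{x^i_l}{\|x^i\|_1-x^i_l+\sigma_i}\bigr)$. Take $f_i(x)=-\sum_{l=1}^L u^i_l(x)$ for $0\le x\le 1$ and $f_i(x)=+\infty$ otherwise, with constraint $\sum_i x^i_l\le p_l$ for all $l$ (that is, $A_i=I$ and $b=(p_l)_l$). (c) Then $p$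 and $d$ are finite, $-p$ is the maximum total throughput, i.e. the supremum of $\sum_{l}\sum_{i}u^i_l(x^i)$ over all $x^i\ge 0$ with $\sum_i x^i_l\le p_l$ for all $l$, and $$p-d\le \frac{\min\{N,L\}}{N}\,\log\frac{1+L/\min\{N,L\}}{\sigma}.$$ -/

import Mathlib

open scoped Matrix

noncomputable section

/-- The optimal value of the separable problem
minimise `∑ i, f i (x i)` subject to `∑ i, A i *ᵥ x i ≤ b` (componentwise). -/
def primalValue {n m : ℕ} {K : Fin n → ℕ} (f : ∀ i, (Fin (K i) → ℝ) → EReal)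
    (A : ∀ i, Matrix (Fin m) (Fin (K i)) ℝ) (b : Fin m → ℝ) : EReal :=
  ⨅ (x : ∀ i, Fin (K i) → ℝ) (_ : ∑ i, A i *ᵥ x i ≤ b), ∑ i, f i (x i)

/-- The conjugate function `f^*(y) = sup_x (⟨y, x⟩ - f x)`. -/
def conjugateFun {k : ℕ} (f : (Fin k → ℝ) → EReal) (y : Fin k → ℝ) : EReal :=
  ⨆ x : Fin k → ℝ, ((y ⬝ᵥ x : ℝ) : EReal) - f x

/-- The optimal value of the dual problem
maximise `-∑ i, (f i)^* (-(A i)ᵀ y) - bᵀ y` subject to `y ≥ 0`. -/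
def dualValue {n m : ℕ} {K : Fin n → ℕ} (f : ∀ i, (Fin (K i) → ℝ) → EReal)
    (A : ∀ i, Matrix (Fin m) (Fin (K i)) ℝ) (b : Fin m → ℝ) : EReal :=
  ⨆ (y : Fin m → ℝ) (_ : 0 ≤ y),
    -(∑ i, conjugateFun (f i) (-((A i)ᵀ *ᵥ y))) - ((b ⬝ᵥ y : ℝ) : EReal)

/-- The optimal value of the utility maximisation problem
maximise `∑ i, U i (x i)` subject to `∑ i, A i *ᵥ x i ≤ b` and `x i ≥ 0` for all `i`. -/
def utilityValue {n m : ℕ} {K : Fin n → ℕ} (U : ∀ i, (Fin (K i) → ℝ) → EReal)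
    (A : ∀ i, Matrix (Fin m) (Fin (K i)) ℝ) (b : Fin m → ℝ) : EReal :=
  ⨆ (x : ∀ i, Fin (K i) → ℝ) (_ : (∀ i, 0 ≤ x i) ∧ ∑ i, A i *ᵥ x i ≤ b), ∑ i, U i (x i)

/-- The extended-valued objective that equals `-U` on the box `0 ≤ x ≤ M`
and `+∞` outside of it. -/
def boxObjective {k : ℕ} (M : ℝ) (U : (Fin k → ℝ) → EReal) (x : Fin k → ℝ) : EReal :=
  if ∀ s, 0 ≤ x s ∧ x s ≤ M then -U x else ⊤

/-- The routing matrix of a user with `k` paths, each given by the set of links it passes. -/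
def routingMatrix {L k : ℕ} (path : Fin k → Finset (Fin L)) : Matrix (Fin L) (Fin k) ℝ :=
  Matrix.of fun l s => if l ∈ path s then 1 else 0

/-- Single-path throughput utility `max_s x_s`. -/
def throughputUtility {k : ℕ} (x : Fin k → ℝ) : EReal :=
  ((⨆ s, x s : ℝ) : EReal)

/-- Single-path logarithmic utility `log (max_s x_s)`, equal to `-∞` if the maximum
is not positive. -/
def logUtility {k : ℕ} (x : Fin k → ℝ) : EReal :=
  if 0 < ⨆ s, x s then ((Real.log (⨆ s, x s) : ℝ) : EReal) else ⊥

/-- The rate of user `l` on a tone with noise `σ` and power vector `x`, when the band is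
divided into `N` tones. -/
def toneRate (N : ℕ) {L : ℕ} (σ : ℝ) (x : Fin L → ℝ) (l : Fin L) : ℝ :=
  1 / (N : ℝ) * Real.log (1 + x l / ((∑ j, |x j|) - x l + σ))

/-- The total rate of all users on one tone. -/
def toneThroughput (N : ℕ) {L : ℕ} (σ : ℝ) (x : Fin L → ℝ) : EReal :=
  ((∑ l, toneRate N σ x l : ℝ) : EReal)

end

open scoped Matrix

/-! Allow each of the `n` blocks a finitely supported probability measure on its domain instead of a
point. By Hahn–Banach, this convexified problem comes within any `ε > 0` of the dual value, once its
`m` constraints are relaxed by `ε` (`exists_multiplier_of_convex`, `exists_blockWeights_le`). The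
measures are nonnegative solutions of `m + n` linear equations, so Carathéodory pruning leaves at
most `m + n` atoms in all (`exists_blockWeights_card_le`). Every block needs one atom, hence at most
`min n m` blocks have several.

Replacing each measure by its barycentre keeps the linear constraints and costs a block with `k`
atoms at most `ρ i k`. Letting `ε → 0`, compactness and lower semicontinuity give `p - d ≤ B` for
any `B` bounding `∑ i, ρ i (k i)` over admissible counts (`exists_duality_gap_le`).

In the applications the loss is `(1 - 1/k)‖c‖`, `log k` or, for `k ≥ 2`, `log (k/σ) / N`. These are
concave in `k`, so a tangent line at the average count `1 + m / min n m` turns the budget on atoms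
into the stated bounds (`sum_le_min_mul`). -/

/-! ### Carathéodory reduction and separation. -/

/-- A nonnegative solution of a linear system can be replaced, without increasing a linear cost,
by one whose support has at most as many elements as the system has equations. -/
theorem exists_finsupp_card_support_le {J V : Type*} [AddCommGroup V] [Module ℝ V]
    [FiniteDimensional ℝ V] (v : J → V) (c : J → ℝ)
    (hv : ∀ β : J →₀ ℝ, Finsupp.linearCombination ℝ v β = 0 → (∀ j, 0 ≤ β j) → β = 0)
    (α : J →₀ ℝ) (hα : ∀ j, 0 ≤ α j) :
    ∃ α' : J →₀ ℝ, (∀ j, 0 ≤ α' j) ∧ α'.support ⊆ α.support ∧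
      Finsupp.linearCombination ℝ v α' = Finsupp.linearCombination ℝ v α ∧
      Finsupp.linearCombination ℝ c α' ≤ Finsupp.linearCombination ℝ c α ∧
      α'.support.card ≤ Module.finrank ℝ V := by
  induction hn : α.support.card using Nat.strong_induction_on generalizing α with
  | _ n ih =>
  by_cases hcard : α.support.card ≤ Module.finrank ℝ V
  · exact ⟨α, hα, subset_rfl, rfl, le_rfl, hcard⟩
  have hdep : ¬ LinearIndepOn ℝ v (α.support : Set J) := by
    intro h
    have := LinearIndependent.fintype_card_le_finrank h
    simp only [Finset.coe_sort_coe, Fintype.card_coe] at this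
    exact hcard this
  have hβ : ∃ β : J →₀ ℝ, β.support ⊆ α.support ∧ Finsupp.linearCombination ℝ v β = 0 ∧ β ≠ 0 ∧
      Finsupp.linearCombination ℝ c β ≤ 0 := by
    rw [linearIndepOn_iff] at hdep
    push Not at hdep
    obtain ⟨β, hs, h0, hne⟩ := hdep
    have hs' : β.support ⊆ α.support := by
      simpa [Finsupp.mem_supported] using hs
    -- The sign of the dependency is free, so it is chosen to make the cost nonincreasing along `β`.
    rcases le_total (Finsupp.linearCombination ℝ c β) 0 with h | h
    · exact ⟨β, hs', h0, hne, h⟩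
    · exact ⟨-β, by simpa using hs', by simp [h0], by simpa using hne, by simpa using h⟩
  obtain ⟨β, hs, h0, hne, hc⟩ := hβ
  have hneg : ∃ j, β j < 0 := by
    by_contra! h
    exact hne (hv β h0 h)
  obtain ⟨j₁, hj₁⟩ := hneg
  have hmem : ∀ j, β j < 0 → j ∈ α.support := fun j hj => hs (by simpa using hj.ne)
  obtain ⟨j₀, hj₀, hmin⟩ := (α.support.filter fun j => β j < 0).exists_min_image
    (fun j => α j / -β j) ⟨j₁, by simp [hmem j₁ hj₁, hj₁, -Finsupp.mem_support_iff]⟩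
  obtain ⟨hj₀s, hj₀n⟩ := Finset.mem_filter.1 hj₀
  -- Ratio test: the longest step along `β` that stays in the orthant; it kills the coordinate `j₀`.
  set t := α j₀ / -β j₀ with ht
  have ht0 : 0 ≤ t := div_nonneg (hα _) (by linarith)
  have hnn : ∀ j, 0 ≤ (α + t • β) j := by
    intro j
    simp only [Finsupp.add_apply, Finsupp.smul_apply, smul_eq_mul]
    rcases lt_or_ge (β j) 0 with h | h
    · have := hmin j (Finset.mem_filter.2 ⟨hmem j h, h⟩)
      rw [le_div_iff₀ (by linarith)] at this
      linarith
    · exact add_nonneg (hα j) (mul_nonneg ht0 h)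
  have hsub : (α + t • β).support ⊆ α.support := by
    intro j hj
    by_contra hjn
    have h1 : α j = 0 := by simpa using hjn
    have h2 : β j = 0 := by
      by_contra h
      exact hjn (hs (by simpa using h))
    simp [h1, h2] at hj
  have hz : (α + t • β) j₀ = 0 := by
    have : -β j₀ ≠ 0 := by linarith
    have h := div_mul_cancel₀ (α j₀) this
    simp only [Finsupp.add_apply, Finsupp.smul_apply, smul_eq_mul]
    rw [← ht] at h
    linarith
  have hlt : (α + t • β).support.card < n := by
    rw [← hn]
    refine Finset.card_lt_card (Finset.ssubset_iff_subset_ne.2 ⟨hsub, fun h => ?_⟩)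
    rw [← h] at hj₀s
    exact (Finsupp.mem_support_iff.1 hj₀s) hz
  obtain ⟨α', h1, h2, h3, h4, h5⟩ := ih _ hlt (α + t • β) hnn rfl
  refine ⟨α', h1, h2.trans hsub, ?_, ?_, h5⟩
  · rw [h3]; simp [h0]
  · refine h4.trans ?_
    simp only [map_add, map_smul, smul_eq_mul]
    nlinarith

/-- Separation of a convex set of pairs (constraint, value) from a lower orthant. -/
theorem exists_multiplier_of_convex {m : ℕ} {C : Set ((Fin m → ℝ) × ℝ)} (hC : Convex ℝ C)
    {b₀ b : Fin m → ℝ} (hb : ∀ l, b₀ l < b l) {a₀ : (Fin m → ℝ) × ℝ} (ha₀ : a₀ ∈ C)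
    (ha₀b : a₀.1 ≤ b₀) {r : ℝ} (hr : ∀ a ∈ C, a.1 ≤ b → r < a.2) :
    ∃ y : Fin m → ℝ, 0 ≤ y ∧ ∀ a ∈ C, r ≤ a.2 + (y ⬝ᵥ a.1 - y ⬝ᵥ b₀) := by
  classical
  set Q : Set ((Fin m → ℝ) × ℝ) := (Set.univ.pi fun l => Set.Iio (b l)) ×ˢ Set.Iio r with hQ
  have hmQ : ∀ z t, (z, t) ∈ Q ↔ (∀ l, z l < b l) ∧ t < r := by
    intro z t; simp [hQ]
  have hQo : IsOpen Q := (isOpen_set_pi Set.finite_univ fun l _ => isOpen_Iio).prod isOpen_Iio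
  have hQc : Convex ℝ Q := (convex_pi fun l _ => convex_Iio _).prod (convex_Iio _)
  have hdisj : Disjoint Q C := by
    rw [Set.disjoint_left]
    rintro ⟨z, t⟩ h1 h2
    rw [hmQ] at h1
    exact absurd (hr _ h2 fun l => (h1.1 l).le) (not_lt.2 h1.2.le)
  obtain ⟨φ, u, hφQ, hφC⟩ := geometric_hahn_banach_open hQc hQo hC hdisj
  set w : Fin m → ℝ := fun l => φ (Pi.single l 1, 0) with hw
  set μ : ℝ := φ (0, 1) with hμ
  have hφ : ∀ z t, φ (z, t) = w ⬝ᵥ z + μ * t := by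
    intro z t
    have h1 : ((z, t) : (Fin m → ℝ) × ℝ) = ContinuousLinearMap.inl ℝ _ _ z + t • (0, 1) := by
      simp
    have h2 : φ (ContinuousLinearMap.inl ℝ (Fin m → ℝ) ℝ z) = w ⬝ᵥ z := by
      have := LinearMap.pi_apply_eq_sum_univ
        ((φ.comp (ContinuousLinearMap.inl ℝ (Fin m → ℝ) ℝ) : (Fin m → ℝ) →L[ℝ] ℝ) :
          (Fin m → ℝ) →ₗ[ℝ] ℝ) z
      simp only [ContinuousLinearMap.coe_coe, ContinuousLinearMap.comp_apply, smul_eq_mul] at this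
      rw [this, dotProduct]
      refine Finset.sum_congr rfl fun l _ => ?_
      rw [mul_comm, hw]
      have h3 : (fun j => if l = j then (1 : ℝ) else 0) = Pi.single l 1 := by
        ext j; simp [Pi.single_apply, eq_comm]
      simp [h3]
    rw [h1, map_add, map_smul, h2, smul_eq_mul, mul_comm]
  have hbound : ∀ (z : Fin m → ℝ) (t : ℝ), (∀ l, 0 < z l) → 0 < t →
      w ⬝ᵥ b + μ * r - (w ⬝ᵥ z + μ * t) < u := by
    intro z t hz ht
    have := hφQ (b - z, r - t) ((hmQ _ _).2 ⟨fun l => by simpa using hz l, by linarith⟩)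
    rw [hφ, dotProduct_sub] at this
    linarith
  -- Small `s` gives `A ≤ u`, large `s` gives `0 ≤ B`; used to read off the signs of `w` and `μ`.
  have hnonneg : ∀ A B : ℝ, (∀ s : ℝ, 0 < s → A - s * B < u) → A ≤ u ∧ 0 ≤ B := by
    intro A B h
    constructor
    · by_contra! hA
      have hB : 0 < |B| + 1 := by positivity
      have h1 := h ((A - u) / (|B| + 1)) (by apply div_pos <;> linarith)
      have h2 : (A - u) / (|B| + 1) * B ≤ A - u := by
        rw [div_mul_eq_mul_div, div_le_iff₀ hB]
        nlinarith [le_abs_self B]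
      linarith
    · by_contra! hB
      have h1 := h ((|u - A| + 1) / -B) (by apply div_pos; positivity; linarith)
      have h2 : (|u - A| + 1) / -B * B = -(|u - A| + 1) := by
        rw [div_neg, neg_mul, div_mul_cancel₀ _ hB.ne]
      linarith [le_abs_self (u - A)]
  have hu : w ⬝ᵥ b + μ * r ≤ u := by
    refine (hnonneg _ (w ⬝ᵥ 1 + μ) fun s hs => ?_).1
    have := hbound (s • 1) s (fun l => by simpa using hs) hs
    rw [dotProduct_smul, smul_eq_mul] at this
    linarith
  have hw0 : ∀ l, 0 ≤ w l := by
    intro l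
    refine (hnonneg (w ⬝ᵥ b + μ * r - (w ⬝ᵥ 1 + μ)) _ fun s hs => ?_).2
    have := hbound (1 + s • Pi.single l 1) 1 (fun j => ?_) one_pos
    · rw [dotProduct_add, dotProduct_smul, dotProduct_single] at this
      simp only [smul_eq_mul, mul_one] at this
      linarith
    · by_cases hj : j = l
      · subst hj; simp; linarith
      · simp [hj]
  have hμ0 : 0 ≤ μ := by
    refine (hnonneg (w ⬝ᵥ b + μ * r - (w ⬝ᵥ 1 + μ)) _ fun s hs => ?_).2
    have := hbound 1 (1 + s) (fun j => by simp) (by linarith)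
    linarith
  have hle : ∀ x y : Fin m → ℝ, x ≤ y → w ⬝ᵥ x ≤ w ⬝ᵥ y := fun x y h =>
    Finset.sum_le_sum fun l _ => mul_le_mul_of_nonneg_left (h l) (hw0 l)
  have hbb : w ⬝ᵥ b₀ ≤ w ⬝ᵥ b := hle _ _ fun l => (hb l).le
  have hCle : ∀ a ∈ C, w ⬝ᵥ b + μ * r ≤ w ⬝ᵥ a.1 + μ * a.2 := fun a ha => by
    have := hφC a ha
    rw [← Prod.mk.eta (p := a), hφ] at this
    exact hu.trans this
  -- A vertical hyperplane (`μ = 0`) is impossible: the strict slack `b₀ < b` at `a₀` forces `w =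
  -- 0`, so `φ = 0`, which separates nothing strictly.
  rcases hμ0.eq_or_lt with h | h
  · exfalso
    have h1 := hCle _ ha₀
    rw [← h] at h1
    have h2 := hle _ _ ha₀b
    have h3 : ∑ l, w l * (b l - b₀ l) = 0 := by
      refine le_antisymm ?_ (Finset.sum_nonneg fun l _ =>
        mul_nonneg (hw0 l) (by linarith [hb l]))
      have : ∑ l, w l * (b l - b₀ l) = w ⬝ᵥ b - w ⬝ᵥ b₀ := by
        rw [← dotProduct_sub]; rfl
      linarith
    have h4 : w = 0 := by
      ext l
      have := (Finset.sum_eq_zero_iff_of_nonneg fun l _ =>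
        mul_nonneg (hw0 l) (by linarith [hb l])).1 h3 l (Finset.mem_univ l)
      rcases mul_eq_zero.1 this with h5 | h5
      · exact h5
      · linarith [hb l]
    have h5 := hφC _ ha₀
    have h6 := hbound 1 1 (fun l => by simp) one_pos
    rw [← Prod.mk.eta (p := a₀), hφ] at h5
    rw [h4, ← h] at h5 h6
    simp at h5 h6
    linarith
  · refine ⟨μ⁻¹ • w, fun l => mul_nonneg (inv_nonneg.2 hμ0) (hw0 l), fun a ha => ?_⟩
    have h1 := hCle a ha
    simp only [smul_dotProduct, smul_eq_mul]
    have h2 : μ * r ≤ μ * (a.2 + (μ⁻¹ * (w ⬝ᵥ a.1) - μ⁻¹ * (w ⬝ᵥ b₀))) := by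
      have : μ * (a.2 + (μ⁻¹ * (w ⬝ᵥ a.1) - μ⁻¹ * (w ⬝ᵥ b₀)))
          = μ * a.2 + (w ⬝ᵥ a.1 - w ⬝ᵥ b₀) := by field_simp
      linarith
    exact le_of_mul_le_mul_left h2 h

/-! ### Extended-valued objectives and their conjugates. -/

/-- The extended-valued function `f` is finite exactly on the bounded nonempty set `D`, where it is
given by the real function `F`; it is bounded below and lower semicontinuous. -/
structure RealizedOn {k : ℕ} (f : (Fin k → ℝ) → EReal) (D : Set (Fin k → ℝ))
    (F : (Fin k → ℝ) → ℝ) : Prop where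
  eq_coe : ∀ x ∈ D, f x = (F x : EReal)
  eq_top : ∀ x ∉ D, f x = ⊤
  nonempty : D.Nonempty
  isBounded : Bornology.IsBounded D
  exists_le : ∃ B, ∀ x ∈ D, B ≤ F x
  lsc : LowerSemicontinuous f

theorem EReal.coe_sum {ι : Type*} (s : Finset ι) (g : ι → ℝ) :
    ((∑ i ∈ s, g i : ℝ) : EReal) = ∑ i ∈ s, (g i : EReal) := by
  classical
  induction s using Finset.induction_on with
  | empty => simp
  | insert a s ha ih => rw [Finset.sum_insert ha, Finset.sum_insert ha, EReal.coe_add, ih]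

theorem EReal.sum_ne_bot {ι : Type*} {s : Finset ι} {g : ι → EReal} (h : ∀ i ∈ s, g i ≠ ⊥) :
    ∑ i ∈ s, g i ≠ ⊥ := by
  classical
  induction s using Finset.induction_on with
  | empty => simp
  | insert a s ha ih =>
    rw [Finset.sum_insert ha, Ne, EReal.add_eq_bot_iff, not_or]
    exact ⟨h a (by simp), ih fun i hi => h i (by simp [hi])⟩

theorem EReal.sum_eq_top {ι : Type*} {s : Finset ι} {g : ι → EReal} (h : ∀ i ∈ s, g i ≠ ⊥)
    {i : ι} (hi : i ∈ s) (hgi : g i = ⊤) : ∑ i ∈ s, g i = ⊤ := by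
  classical
  rw [← Finset.add_sum_erase s g hi, hgi]
  exact EReal.top_add_of_ne_bot (EReal.sum_ne_bot fun j hj => h j (Finset.mem_of_mem_erase hj))

namespace RealizedOn

variable {k : ℕ} {f : (Fin k → ℝ) → EReal} {D : Set (Fin k → ℝ)} {F : (Fin k → ℝ) → ℝ}

theorem bddAbove_image (h : RealizedOn f D F) (z : Fin k → ℝ) :
    BddAbove ((fun x => z ⬝ᵥ x - F x) '' D) := by
  obtain ⟨B, hB⟩ := h.exists_le
  have hc : IsCompact (closure D) := h.isBounded.isCompact_closure
  have hcont : Continuous fun x : Fin k → ℝ => z ⬝ᵥ x := by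
    unfold dotProduct; fun_prop
  obtain ⟨M, hM⟩ := (hc.image hcont).bddAbove
  refine ⟨M - B, ?_⟩
  rintro _ ⟨x, hx, rfl⟩
  have := hM ⟨x, subset_closure hx, rfl⟩
  have := hB x hx
  simp only at *
  linarith

theorem conjugateFun_eq (h : RealizedOn f D F) (z : Fin k → ℝ) :
    conjugateFun f z = ((sSup ((fun x => z ⬝ᵥ x - F x) '' D) : ℝ) : EReal) := by
  apply le_antisymm
  · refine iSup_le fun x => ?_
    by_cases hx : x ∈ D
    · rw [h.eq_coe x hx, ← EReal.coe_sub, EReal.coe_le_coe_iff]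
      exact le_csSup (h.bddAbove_image z) ⟨x, hx, rfl⟩
    · rw [h.eq_top x hx]; simp
  · have hne : ((fun x => z ⬝ᵥ x - F x) '' D).Nonempty := h.nonempty.image _
    have hnb : conjugateFun f z ≠ ⊥ := by
      obtain ⟨x, hx⟩ := h.nonempty
      refine ne_bot_of_le_ne_bot ?_ (le_iSup (fun x => ((z ⬝ᵥ x : ℝ) : EReal) - f x) x)
      rw [h.eq_coe x hx, ← EReal.coe_sub]
      exact EReal.coe_ne_bot _
    by_cases ht : conjugateFun f z = ⊤
    · rw [ht]; exact le_top
    rw [← EReal.coe_toReal ht hnb, EReal.coe_le_coe_iff]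
    refine csSup_le hne ?_
    rintro _ ⟨x, hx, rfl⟩
    rw [← EReal.coe_le_coe_iff, EReal.coe_toReal ht hnb, EReal.coe_sub, ← h.eq_coe x hx]
    exact le_iSup (fun x => ((z ⬝ᵥ x : ℝ) : EReal) - f x) x

end RealizedOn

/-- If `∑ i, g i (x i)` is bounded over a product set, then the sum of the suprema obeys the same
bound. -/
theorem sum_csSup_image_le {n : ℕ} {X : Fin n → Type*} {D : ∀ i, Set (X i)}
    (g : ∀ i, X i → ℝ) (hD : ∀ i, (D i).Nonempty) {C : ℝ}
    (h : ∀ x : ∀ i, X i, (∀ i, x i ∈ D i) → ∑ i, g i (x i) ≤ C) :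
    ∑ i, sSup (g i '' D i) ≤ C := by
  refine le_of_forall_pos_le_add fun ε hε => ?_
  -- The denominator `n + 1` also covers `n = 0`.
  have hδ : 0 < ε / (n + 1) := by positivity
  have hx : ∀ i, ∃ x ∈ D i, sSup (g i '' D i) - ε / (n + 1) < g i x := by
    intro i
    obtain ⟨_, ⟨x, hx, rfl⟩, h2⟩ :=
      exists_lt_of_lt_csSup ((hD i).image (g i)) (sub_lt_self _ hδ)
    exact ⟨x, hx, h2⟩
  choose x hxD hxg using hx
  have h1 := h x hxD
  have h2 : ∑ i, (sSup (g i '' D i) - ε / (n + 1)) ≤ ∑ i, g i (x i) :=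
    Finset.sum_le_sum fun i _ => (hxg i).le
  rw [Finset.sum_sub_distrib, Finset.sum_const, Finset.card_univ, Fintype.card_fin,
    nsmul_eq_mul] at h2
  have h3 : (n : ℝ) * (ε / (n + 1)) ≤ ε := by
    rw [mul_div_assoc', div_le_iff₀ (by positivity)]
    nlinarith
  linarith

/-! ### Duality gap of a separable problem. -/

section Separable

variable {n m : ℕ} {K : Fin n → ℕ}

/-- The value of the dual objective, when all blocks are real-valued on `D i`. -/
noncomputable def dualObjective (D : ∀ i, Set (Fin (K i) → ℝ)) (F : ∀ i, (Fin (K i) → ℝ) → ℝ)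
    (A : ∀ i, Matrix (Fin m) (Fin (K i)) ℝ) (b y : Fin m → ℝ) : ℝ :=
  -(∑ i, sSup ((fun x => -((A i)ᵀ *ᵥ y) ⬝ᵥ x - F i x) '' D i)) - b ⬝ᵥ y

variable {f : ∀ i, (Fin (K i) → ℝ) → EReal} {D : ∀ i, Set (Fin (K i) → ℝ)}
  {F : ∀ i, (Fin (K i) → ℝ) → ℝ} {A : ∀ i, Matrix (Fin m) (Fin (K i)) ℝ} {b : Fin m → ℝ}

theorem dualValue_eq (hf : ∀ i, RealizedOn (f i) (D i) (F i)) :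
    dualValue f A b = ⨆ (y : Fin m → ℝ) (_ : 0 ≤ y), (dualObjective D F A b y : EReal) := by
  unfold dualValue dualObjective
  simp_rw [fun i => (hf i).conjugateFun_eq, ← EReal.coe_sum, ← EReal.coe_neg, ← EReal.coe_sub]

theorem transpose_mulVec_dotProduct_sum (y : Fin m → ℝ) (x : ∀ i, Fin (K i) → ℝ) :
    ∑ i, (-((A i)ᵀ *ᵥ y) ⬝ᵥ x i - F i (x i)) = -(y ⬝ᵥ ∑ i, A i *ᵥ x i) - ∑ i, F i (x i) := by
  rw [Finset.sum_sub_distrib, dotProduct_sum, ← Finset.sum_neg_distrib]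
  congr 1
  refine Finset.sum_congr rfl fun i _ => ?_
  rw [neg_dotProduct, Matrix.mulVec_transpose, Matrix.dotProduct_mulVec]

/-- Weak duality: the dual objective is the infimum of the Lagrangian over the product of the `D i`.
-/
theorem dualObjective_le (hf : ∀ i, RealizedOn (f i) (D i) (F i)) (y : Fin m → ℝ)
    {x : ∀ i, Fin (K i) → ℝ} (hx : ∀ i, x i ∈ D i) :
    dualObjective D F A b y ≤ ∑ i, F i (x i) + (y ⬝ᵥ ∑ i, A i *ᵥ x i - y ⬝ᵥ b) := by
  have h := Finset.sum_le_sum fun i (_ : i ∈ Finset.univ) =>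
    le_csSup ((hf i).bddAbove_image (-((A i)ᵀ *ᵥ y))) ⟨x i, hx i, rfl⟩
  simp only at h
  rw [transpose_mulVec_dotProduct_sum] at h
  rw [dualObjective, dotProduct_comm b]
  linarith

/-- The other half of that infimum: the Lagrangian separates, so the blockwise suprema can be
approached simultaneously. -/
theorem le_dualObjective (hf : ∀ i, RealizedOn (f i) (D i) (F i)) {y : Fin m → ℝ} {r : ℝ}
    (h : ∀ x : ∀ i, Fin (K i) → ℝ, (∀ i, x i ∈ D i) →
      r ≤ ∑ i, F i (x i) + (y ⬝ᵥ ∑ i, A i *ᵥ x i - y ⬝ᵥ b)) :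
    r ≤ dualObjective D F A b y := by
  have h1 : ∑ i, sSup ((fun x => -((A i)ᵀ *ᵥ y) ⬝ᵥ x - F i x) '' D i) ≤ -(y ⬝ᵥ b) - r := by
    refine sum_csSup_image_le _ (fun i => (hf i).nonempty) fun x hx => ?_
    rw [transpose_mulVec_dotProduct_sum]
    linarith [h x hx]
  rw [dualObjective, dotProduct_comm b]
  linarith

/-- Families of finitely supported probability weights on the sets `D i`. -/
def blockWeights (D : ∀ i, Set (Fin (K i) → ℝ)) : Set ((Σ i, Fin (K i) → ℝ) →₀ ℝ) :=
  {α | (∀ j, 0 ≤ α j) ∧ (∀ j : Σ i, Fin (K i) → ℝ, j.2 ∉ D j.1 → α j = 0) ∧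
    Finsupp.linearCombination ℝ (fun j : Σ i, Fin (K i) → ℝ => (Pi.single j.1 1 : Fin n → ℝ)) α
      = 1}

theorem convex_blockWeights : Convex ℝ (blockWeights D) := by
  rintro α ⟨h1, h2, h3⟩ β ⟨h4, h5, h6⟩ s t hs ht hst
  refine ⟨fun j => ?_, fun j hj => ?_, ?_⟩
  · exact add_nonneg (mul_nonneg hs (h1 j)) (mul_nonneg ht (h4 j))
  · simp [h2 j hj, h5 j hj]
  · rw [map_add, map_smul, map_smul, h3, h6, ← add_smul, hst, one_smul]

/-- The convexified problem comes arbitrarily close to the dual value. -/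
theorem exists_blockWeights_le (hf : ∀ i, RealizedOn (f i) (D i) (F i)) {d ε : ℝ} (hε : 0 < ε)
    (hd : ∀ y, 0 ≤ y → dualObjective D F A b y ≤ d)
    {x₀ : ∀ i, Fin (K i) → ℝ} (hx₀ : ∀ i, x₀ i ∈ D i) (hx₀b : ∑ i, A i *ᵥ x₀ i ≤ b) :
    ∃ α ∈ blockWeights D,
      Finsupp.linearCombination ℝ (fun j : Σ i, Fin (K i) → ℝ => A j.1 *ᵥ j.2) α
        ≤ b + (fun _ => ε) ∧
      Finsupp.linearCombination ℝ (fun j : Σ i, Fin (K i) → ℝ => F j.1 j.2) α ≤ d + ε := by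
  by_contra! hcon
  set T := (Finsupp.linearCombination ℝ (fun j : Σ i, Fin (K i) → ℝ => A j.1 *ᵥ j.2)).prod
    (Finsupp.linearCombination ℝ (fun j : Σ i, Fin (K i) → ℝ => F j.1 j.2)) with hT
  have hpt : ∀ x : ∀ i, Fin (K i) → ℝ, (∀ i, x i ∈ D i) →
      (∑ i, A i *ᵥ x i, ∑ i, F i (x i)) ∈ T '' blockWeights D := by
    classical
    intro x hx
    refine ⟨∑ i, Finsupp.single ⟨i, x i⟩ 1, ⟨fun j => ?_, fun j hj => ?_, ?_⟩, ?_⟩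
    · rw [Finsupp.finsetSum_apply]
      exact Finset.sum_nonneg fun i _ => by
        rw [Finsupp.single_apply]; split_ifs <;> simp
    · rw [Finsupp.finsetSum_apply]
      refine Finset.sum_eq_zero fun i _ => ?_
      rw [Finsupp.single_apply, if_neg]
      rintro rfl
      exact hj (hx i)
    · ext l
      simp [Finset.sum_apply, Pi.single_apply]
    · simp [hT, Prod.ext_iff, Prod.fst_sum, Prod.snd_sum]
  -- The relaxation by `ε` supplies the strict slack, so mere feasibility of `x₀` replaces Slater's
  -- condition. The resulting `y` has dual objective at least `d + ε`, a contradiction.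
  obtain ⟨y, hy, hyC⟩ := exists_multiplier_of_convex
    (convex_blockWeights.linear_image T) (b₀ := b) (b := b + fun _ => ε)
    (fun l => by simpa using hε) (hpt x₀ hx₀) hx₀b (r := d + ε) (by
      rintro _ ⟨α, hα, rfl⟩ h
      exact hcon α hα h)
  have := le_dualObjective hf fun x hx => hyC _ (hpt x hx)
  linarith [hd y hy]

theorem linearCombination_sigma {V : Type*} [AddCommGroup V] [Module ℝ V]
    (α : (Σ i, Fin (K i) → ℝ) →₀ ℝ) (g : (Σ i, Fin (K i) → ℝ) → V) :
    Finsupp.linearCombination ℝ g α =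
      ∑ i, ∑ x ∈ (α.split i).support, α ⟨i, x⟩ • g ⟨i, x⟩ := by
  rw [Finsupp.linearCombination_apply, Finsupp.sigma_sum]
  simp only [Finsupp.sum, Finsupp.split_apply]
  refine Finset.sum_subset (Finset.subset_univ _) fun i _ hi => ?_
  rw [Finsupp.mem_splitSupport_iff_nonzero, not_not] at hi
  simp [hi]

theorem card_support_sigma (α : (Σ i, Fin (K i) → ℝ) →₀ ℝ) :
    α.support.card = ∑ i, (α.split i).support.card := by
  rw [Finsupp.sigma_support, Finset.card_sigma]
  refine Finset.sum_subset (Finset.subset_univ _) fun i _ hi => ?_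
  rw [Finsupp.mem_splitSupport_iff_nonzero, not_not] at hi
  simp [hi]

/-- Refined Shapley–Folkman: in the convexified problem, at most `m + n` points are needed in
total. -/
theorem exists_blockWeights_card_le {α : (Σ i, Fin (K i) → ℝ) →₀ ℝ} (hα : α ∈ blockWeights D) :
    ∃ α' ∈ blockWeights D,
      Finsupp.linearCombination ℝ (fun j : Σ i, Fin (K i) → ℝ => A j.1 *ᵥ j.2) α' =
        Finsupp.linearCombination ℝ (fun j : Σ i, Fin (K i) → ℝ => A j.1 *ᵥ j.2) α ∧
      Finsupp.linearCombination ℝ (fun j : Σ i, Fin (K i) → ℝ => F j.1 j.2) α' ≤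
        Finsupp.linearCombination ℝ (fun j : Σ i, Fin (K i) → ℝ => F j.1 j.2) α ∧
      ∑ i, (α'.split i).support.card ≤ m + n := by
  have hprod : ∀ β : (Σ i, Fin (K i) → ℝ) →₀ ℝ,
      Finsupp.linearCombination ℝ
        (fun j : Σ i, Fin (K i) → ℝ => (A j.1 *ᵥ j.2, (Pi.single j.1 1 : Fin n → ℝ))) β =
      (Finsupp.linearCombination ℝ (fun j : Σ i, Fin (K i) → ℝ => A j.1 *ᵥ j.2) β,
        Finsupp.linearCombination ℝ
          (fun j : Σ i, Fin (K i) → ℝ => (Pi.single j.1 1 : Fin n → ℝ)) β) := by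
    intro β
    simp only [Finsupp.linearCombination_apply, Finsupp.sum]
    ext <;> simp [Prod.fst_sum, Prod.snd_sum]
  -- The second component records the total weight of each block, so a nonnegative kernel element
  -- has all weights zero.
  have hker : ∀ β : (Σ i, Fin (K i) → ℝ) →₀ ℝ, Finsupp.linearCombination ℝ
      (fun j : Σ i, Fin (K i) → ℝ => (A j.1 *ᵥ j.2, (Pi.single j.1 1 : Fin n → ℝ))) β = 0 →
      (∀ j, 0 ≤ β j) → β = 0 := by
    intro β hβ hβ0
    rw [hprod, Prod.mk_eq_zero] at hβ
    ext ⟨i, x⟩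
    have h := congrFun hβ.2 i
    rw [Finsupp.linearCombination_apply, Finsupp.sum, Finset.sum_apply, Pi.zero_apply,
      Finset.sum_eq_zero_iff_of_nonneg] at h
    · by_contra hne
      have := h ⟨i, x⟩ (Finsupp.mem_support_iff.2 hne)
      simp at this
      exact hne this
    · intro j _
      simp only [Pi.smul_apply, smul_eq_mul, Pi.single_apply]
      split_ifs <;> simp [hβ0 j]
  -- The objective only has to not increase, so it is a cost and not an equation: the dimension is
  -- `m + n` rather than `m + n + 1`.
  obtain ⟨α', h1, h2, h3, h4, h5⟩ := exists_finsupp_card_support_le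
    (fun j : Σ i, Fin (K i) → ℝ => (A j.1 *ᵥ j.2, (Pi.single j.1 1 : Fin n → ℝ)))
    (fun j => F j.1 j.2) hker α hα.1
  rw [hprod, hprod, Prod.mk.injEq] at h3
  refine ⟨α', ⟨h1, fun j hj => ?_, h3.2.trans hα.2.2⟩, h3.1, h4, ?_⟩
  · by_contra hne
    exact Finsupp.mem_support_iff.1 (h2 (Finsupp.mem_support_iff.2 hne)) (hα.2.1 j hj)
  · rw [← card_support_sigma]
    simpa using h5

/-- The barycentres of the pruned measures satisfy the same linear constraints; `ρ i k` is the loss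
from averaging `k` points of block `i`. -/
theorem exists_approx_solution (hf : ∀ i, RealizedOn (f i) (D i) (F i))
    (hD : ∀ i, Convex ℝ (D i)) (ρ : Fin n → ℕ → ℝ)
    (hρ : ∀ i (s : Finset (Fin (K i) → ℝ)) (w : (Fin (K i) → ℝ) → ℝ), (∀ x ∈ s, x ∈ D i) →
      (∀ x ∈ s, 0 < w x) → ∑ x ∈ s, w x = 1 →
      F i (∑ x ∈ s, w x • x) ≤ ∑ x ∈ s, w x * F i x + ρ i s.card)
    {B : ℝ} (hB : ∀ k : Fin n → ℕ, (∀ i, 1 ≤ k i) → ∑ i, k i ≤ m + n → ∑ i, ρ i (k i) ≤ B)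
    {d ε : ℝ} (hε : 0 < ε) (hd : ∀ y, 0 ≤ y → dualObjective D F A b y ≤ d)
    {x₀ : ∀ i, Fin (K i) → ℝ} (hx₀ : ∀ i, x₀ i ∈ D i) (hx₀b : ∑ i, A i *ᵥ x₀ i ≤ b) :
    ∃ x : ∀ i, Fin (K i) → ℝ, (∀ i, x i ∈ D i) ∧ ∑ i, A i *ᵥ x i ≤ b + (fun _ => ε) ∧
      ∑ i, F i (x i) ≤ d + B + ε := by
  obtain ⟨α₀, hα₀, hA₀, hF₀⟩ := exists_blockWeights_le hf hε hd hx₀ hx₀b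
  obtain ⟨α, hα, hA, hF, hcard⟩ := exists_blockWeights_card_le (A := A) (F := F) hα₀
  have hA' := hA.le.trans hA₀
  have hF' := hF.trans hF₀
  rw [linearCombination_sigma] at hA' hF'
  set s : ∀ i, Finset (Fin (K i) → ℝ) := fun i => (α.split i).support with hs
  have hmem : ∀ i x, x ∈ s i ↔ α ⟨i, x⟩ ≠ 0 := by
    intro i x
    rw [hs, Finsupp.mem_support_iff, Finsupp.split_apply]
  have hsD : ∀ i, ∀ x ∈ s i, x ∈ D i := fun i x hx => by
    by_contra hn
    exact (hmem i x).1 hx (hα.2.1 ⟨i, x⟩ hn)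
  have hpos : ∀ i, ∀ x ∈ s i, 0 < α ⟨i, x⟩ := fun i x hx =>
    (hα.1 _).lt_of_ne ((hmem i x).1 hx).symm
  have hsum : ∀ i, ∑ x ∈ s i, α ⟨i, x⟩ = 1 := by
    intro i
    have h := congrFun hα.2.2 i
    rw [linearCombination_sigma, Finset.sum_apply, Finset.sum_eq_single i] at h
    · simpa [Finset.sum_apply] using h
    · intro j _ hj
      simp [Finset.sum_apply, hj.symm]
    · simp
  refine ⟨fun i => ∑ x ∈ s i, α ⟨i, x⟩ • x, fun i => ?_, ?_, ?_⟩
  · exact (hD i).sum_mem (fun x hx => (hpos i x hx).le) (hsum i) (hsD i)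
  · simpa only [Matrix.mulVec_sum, Matrix.mulVec_smul] using hA'
  · have h1 : ∑ i, F i (∑ x ∈ s i, α ⟨i, x⟩ • x) ≤
        ∑ i, (∑ x ∈ s i, α ⟨i, x⟩ * F i x + ρ i (s i).card) :=
      Finset.sum_le_sum fun i _ => hρ i (s i) (fun x => α ⟨i, x⟩) (hsD i) (hpos i) (hsum i)
    rw [Finset.sum_add_distrib] at h1
    have h2 := hB (fun i => (s i).card) (fun i => Finset.card_pos.2 (by
      rw [Finset.nonempty_iff_ne_empty]
      intro h
      have := hsum i
      rw [h] at this
      simp at this)) hcard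
    simp only [smul_eq_mul] at hF'
    linarith

/-- Duality gap estimate for separable problems with bounded domains. -/
theorem exists_duality_gap_le (hf : ∀ i, RealizedOn (f i) (D i) (F i))
    (hD : ∀ i, Convex ℝ (D i)) (ρ : Fin n → ℕ → ℝ)
    (hρ : ∀ i (s : Finset (Fin (K i) → ℝ)) (w : (Fin (K i) → ℝ) → ℝ), (∀ x ∈ s, x ∈ D i) →
      (∀ x ∈ s, 0 < w x) → ∑ x ∈ s, w x = 1 →
      F i (∑ x ∈ s, w x • x) ≤ ∑ x ∈ s, w x * F i x + ρ i s.card)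
    {B : ℝ} (hB : ∀ k : Fin n → ℕ, (∀ i, 1 ≤ k i) → ∑ i, k i ≤ m + n → ∑ i, ρ i (k i) ≤ B)
    {x₀ : ∀ i, Fin (K i) → ℝ} (hx₀ : ∀ i, x₀ i ∈ D i) (hx₀b : ∑ i, A i *ᵥ x₀ i ≤ b) :
    ∃ p d : ℝ, primalValue f A b = (p : EReal) ∧ dualValue f A b = (d : EReal) ∧ p - d ≤ B := by
  have hle : ∀ y : Fin m → ℝ, 0 ≤ y → dualObjective D F A b y ≤ ∑ i, F i (x₀ i) := by
    intro y hy
    have h1 := dualObjective_le (A := A) (b := b) hf y hx₀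
    have h2 : y ⬝ᵥ ∑ i, A i *ᵥ x₀ i ≤ y ⬝ᵥ b :=
      Finset.sum_le_sum fun l _ => mul_le_mul_of_nonneg_left (hx₀b l) (hy l)
    linarith
  obtain ⟨d, hd⟩ : ∃ d : ℝ, dualValue f A b = d := by
    have h1 : dualValue f A b ≠ ⊤ := by
      refine ne_top_of_le_ne_top (EReal.coe_ne_top (∑ i, F i (x₀ i))) ?_
      rw [dualValue_eq hf]
      exact iSup₂_le fun y hy => EReal.coe_le_coe_iff.2 (hle y hy)
    have h2 : dualValue f A b ≠ ⊥ := by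
      refine ne_bot_of_le_ne_bot (EReal.coe_ne_bot (dualObjective D F A b 0)) ?_
      rw [dualValue_eq hf]
      exact le_iSup₂ (f := fun (y : Fin m → ℝ) (_ : 0 ≤ y) => (dualObjective D F A b y : EReal))
        0 le_rfl
    exact ⟨_, (EReal.coe_toReal h1 h2).symm⟩
  have hdy : ∀ y, 0 ≤ y → dualObjective D F A b y ≤ d := by
    intro y hy
    rw [← EReal.coe_le_coe_iff, ← hd, dualValue_eq hf]
    exact le_iSup₂ (f := fun (y : Fin m → ℝ) (_ : 0 ≤ y) => (dualObjective D F A b y : EReal))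
      y hy
  have happ : ∀ N : ℕ, _ := fun N =>
    exists_approx_solution hf hD ρ hρ hB (ε := 1 / ((N : ℝ) + 1)) (by positivity) hdy hx₀ hx₀b
  choose u huD huA huF using happ
  have hcomp : IsCompact (Set.univ.pi fun i => closure (D i)) :=
    isCompact_univ_pi fun i => (hf i).isBounded.isCompact_closure
  obtain ⟨x, -, φ, hφ, hlim⟩ := hcomp.tendsto_subseq (x := u)
    fun N i _ => subset_closure (huD N i)
  have hε : Filter.Tendsto (fun N : ℕ => 1 / (((φ N : ℕ) : ℝ) + 1)) Filter.atTop (nhds 0) :=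
    tendsto_one_div_add_atTop_nhds_zero_nat.comp hφ.tendsto_atTop
  have hxA : ∑ i, A i *ᵥ x i ≤ b := by
    intro l
    have h1 : Continuous fun x : ∀ i, Fin (K i) → ℝ => (∑ i, A i *ᵥ x i) l := by
      simp only [Finset.sum_apply, Matrix.mulVec, dotProduct]
      fun_prop
    have h2 := hε.const_add (b l)
    rw [add_zero] at h2
    exact le_of_tendsto_of_tendsto' ((h1.tendsto x).comp hlim) h2 fun N => huA (φ N) l
  choose β hβ using fun i => (hf i).exists_le
  have hlimi : ∀ i, Filter.Tendsto (fun N => u (φ N) i) Filter.atTop (nhds (x i)) := fun i =>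
    ((continuous_apply i).tendsto x).comp hlim
  have hev : ∀ i (t : ℝ), (t : EReal) < f i (x i) → ∀ᶠ N in Filter.atTop, t < F i (u (φ N) i) := by
    intro i t ht
    filter_upwards [(hlimi i).eventually ((hf i).lsc (x i) t ht)] with N hN
    rw [(hf i).eq_coe _ (huD _ _)] at hN
    exact EReal.coe_lt_coe_iff.1 hN
  -- If the limit left `D i`, lower semicontinuity would push `F i` above any level along the
  -- sequence, while the total stays below `d + B + 1` and the other blocks are bounded below.
  have hxD : ∀ i, x i ∈ D i := by
    intro i
    by_contra hi
    obtain ⟨N, hN⟩ := (hev i (d + B + 1 - ∑ j ∈ Finset.univ.erase i, β j)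
      (by rw [(hf i).eq_top _ hi]; exact EReal.coe_lt_top _)).exists
    have h1 := huF (φ N)
    rw [← Finset.add_sum_erase _ _ (Finset.mem_univ i)] at h1
    have h2 : ∑ j ∈ Finset.univ.erase i, β j ≤ ∑ j ∈ Finset.univ.erase i, F j (u (φ N) j) :=
      Finset.sum_le_sum fun j _ => hβ j _ (huD _ _)
    have h3 : 1 / (((φ N : ℕ) : ℝ) + 1) ≤ 1 := by
      rw [div_le_one (by positivity)]
      simp
    linarith
  have hxF : ∑ i, F i (x i) ≤ d + B := by
    refine le_of_forall_pos_le_add fun δ hδ => ?_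
    have h1 : ∀ᶠ N in Filter.atTop, ∀ i, F i (x i) - δ / (2 * (n + 1)) < F i (u (φ N) i) := by
      rw [Filter.eventually_all]
      intro i
      refine hev i _ ?_
      rw [(hf i).eq_coe _ (hxD i), EReal.coe_lt_coe_iff]
      exact sub_lt_self _ (by positivity)
    obtain ⟨N, h2, h3⟩ := (h1.and (hε.eventually (gt_mem_nhds (half_pos hδ)))).exists
    have h4 : ∑ i, (F i (x i) - δ / (2 * (n + 1))) ≤ ∑ i, F i (u (φ N) i) :=
      Finset.sum_le_sum fun i _ => (h2 i).le
    rw [Finset.sum_sub_distrib, Finset.sum_const, Finset.card_univ, Fintype.card_fin,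
      nsmul_eq_mul] at h4
    have h5 : (n : ℝ) * (δ / (2 * (n + 1))) ≤ δ / 2 := by
      rw [mul_div_assoc', div_le_div_iff₀ (by positivity) (by positivity)]
      nlinarith
    linarith [huF (φ N)]
  have hple : primalValue f A b ≤ ((d + B : ℝ) : EReal) := by
    refine (iInf₂_le x hxA).trans ?_
    rw [Finset.sum_congr rfl fun i _ => (hf i).eq_coe _ (hxD i), ← EReal.coe_sum]
    exact EReal.coe_le_coe_iff.2 hxF
  have hpge : ((∑ i, β i : ℝ) : EReal) ≤ primalValue f A b := by
    refine le_iInf₂ fun z _ => ?_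
    rw [EReal.coe_sum]
    refine Finset.sum_le_sum fun i _ => ?_
    by_cases hz : z i ∈ D i
    · rw [(hf i).eq_coe _ hz]
      exact EReal.coe_le_coe_iff.2 (hβ i _ hz)
    · rw [(hf i).eq_top _ hz]
      exact le_top
  have hp1 := ne_top_of_le_ne_top (EReal.coe_ne_top _) hple
  have hp2 := ne_bot_of_le_ne_bot (EReal.coe_ne_bot _) hpge
  refine ⟨(primalValue f A b).toReal, d, (EReal.coe_toReal hp1 hp2).symm, hd, ?_⟩
  rw [← EReal.coe_toReal hp1 hp2, EReal.coe_le_coe_iff] at hple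
  linarith

end Separable

/-! ### Counting atoms, and objectives on a box. -/

/-- The counting step: among `n` blocks using at most `m + n` points in total, only `min n m` can
contribute, and a linear majorant of the contributions suffices. -/
theorem sum_le_min_mul {n m : ℕ} (hn : 1 ≤ n) (hm : 1 ≤ m) {B s : ℝ} (hs : 0 ≤ s)
    {k : Fin n → ℕ} (hk : ∀ i, 1 ≤ k i) (hsum : ∑ i, k i ≤ m + n) {r : Fin n → ℝ}
    (hr : ∀ i, r i ≤ B + s * (k i - (1 + (m : ℝ) / (min n m : ℕ))))
    (hr1 : ∀ i, k i = 1 → r i ≤ 0) :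
    ∑ i, r i ≤ (min n m : ℕ) * B := by
  have hq : 0 < min n m := by omega
  have hsum' : ∀ T : Finset (Fin n), ∑ i ∈ T, (k i - 1) ≤ m := by
    intro T
    have h1 : ∑ i, (k i - 1) + n = ∑ i, k i := by
      have : ∑ i : Fin n, 1 = n := by simp
      rw [← Finset.sum_congr rfl fun i _ => Nat.sub_add_cancel (hk i), Finset.sum_add_distrib, this]
    have h2 : ∑ i ∈ T, (k i - 1) ≤ ∑ i, (k i - 1) :=
      Finset.sum_le_sum_of_subset (Finset.subset_univ T)
    omega
  have hcard : (Finset.univ.filter fun i => k i ≠ 1).card ≤ min n m := by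
    refine le_min ?_ ?_
    · simpa using Finset.card_le_univ (Finset.univ.filter fun i => k i ≠ 1)
    · refine le_trans ?_ (hsum' (Finset.univ.filter fun i => k i ≠ 1))
      rw [Finset.card_eq_sum_ones]
      refine Finset.sum_le_sum fun i hi => ?_
      have h1 := (Finset.mem_filter.1 hi).2
      have h2 := hk i
      omega
  -- Padding to exactly `min n m` blocks makes the subtracted terms `m / min n m` add up to `m`,
  -- which dominates the number of excess atoms.
  obtain ⟨T, hT, hTc⟩ := Finset.exists_superset_card_eq hcard (by simp)
  have h1 : ∑ i, r i ≤ ∑ i ∈ T, r i := by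
    rw [← Finset.sum_add_sum_compl T]
    have : ∑ i ∈ Tᶜ, r i ≤ 0 := Finset.sum_nonpos fun i hi => by
      refine hr1 i ?_
      by_contra h
      exact Finset.mem_compl.1 hi (hT (by simp [h]))
    linarith
  have h2 : ∑ i ∈ T, r i ≤ ∑ i ∈ T, (B + s * (((k i - 1 : ℕ) : ℝ) - (m : ℝ) / (min n m : ℕ))) := by
    refine Finset.sum_le_sum fun i _ => ?_
    have := hr i
    rw [Nat.cast_sub (hk i)]
    push_cast at this ⊢
    linarith
  rw [Finset.sum_add_distrib, ← Finset.mul_sum, Finset.sum_sub_distrib, Finset.sum_const,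
    Finset.sum_const, hTc, nsmul_eq_mul, nsmul_eq_mul, mul_div_cancel₀ _ (by positivity),
    ← Nat.cast_sum] at h2
  have h3 : ((∑ i ∈ T, (k i - 1) : ℕ) : ℝ) ≤ m := by exact_mod_cast hsum' T
  nlinarith

theorem mem_box_iff {k : ℕ} {M : ℝ} {x : Fin k → ℝ} :
    (∀ s, 0 ≤ x s ∧ x s ≤ M) ↔ x ∈ Set.Icc 0 (fun _ : Fin k => M) :=
  ⟨fun h => ⟨fun s => (h s).1, fun s => (h s).2⟩, fun h s => ⟨h.1 s, h.2 s⟩⟩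

/-- Continuity of `U` is taken in `EReal`, so it includes points where `U = ⊥`; with the closed box
it gives lower semicontinuity. -/
theorem realizedOn_boxObjective {k : ℕ} {M : ℝ} {U : (Fin k → ℝ) → EReal} {D : Set (Fin k → ℝ)}
    {F : (Fin k → ℝ) → ℝ} (hU : ContinuousOn U (Set.Icc 0 fun _ => M))
    (hD : ∀ x, x ∈ D ↔ x ∈ Set.Icc 0 (fun _ : Fin k => M) ∧ U x ≠ ⊥)
    (hF : ∀ x ∈ D, U x = ((-F x : ℝ) : EReal)) (hne : D.Nonempty) (hB : ∃ B, ∀ x ∈ D, B ≤ F x) :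
    RealizedOn (boxObjective M U) D F where
  eq_coe x hx := by
    rw [boxObjective, if_pos (mem_box_iff.2 ((hD x).1 hx).1), hF x hx, ← EReal.coe_neg, neg_neg]
  eq_top x hx := by
    rw [boxObjective]
    split_ifs with h
    · have : U x = ⊥ := by
        by_contra hn
        exact hx ((hD x).2 ⟨mem_box_iff.1 h, hn⟩)
      rw [this, EReal.neg_bot]
    · rfl
  nonempty := hne
  isBounded := (Metric.isBounded_Icc _ _).subset fun x hx => ((hD x).1 hx).1
  exists_le := hB
  lsc := by
    intro x y hy
    by_cases hx : x ∈ Set.Icc 0 (fun _ : Fin k => M)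
    · have h1 : boxObjective M U x = -U x := if_pos (mem_box_iff.2 hx)
      rw [h1] at hy
      have h2 := (continuous_neg.continuousAt.tendsto.comp (hU x hx)).eventually (lt_mem_nhds hy)
      rw [eventually_nhdsWithin_iff] at h2
      filter_upwards [h2] with z hz
      rw [boxObjective]
      split_ifs with h
      · exact hz (mem_box_iff.1 h)
      · exact lt_of_lt_of_le hy le_top
    · filter_upwards [isClosed_Icc.isOpen_compl.mem_nhds hx] with z hz
      rw [boxObjective, if_neg fun h => hz (mem_box_iff.1 h)]
      rw [boxObjective, if_neg fun h => hx (mem_box_iff.1 h)] at hy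
      exact hy

/-- A problem over the box with objective `-U` is the utility maximisation problem when the
constraints force the variables into the box. -/
theorem primalValue_boxObjective_eq_neg {n m : ℕ} {K : Fin n → ℕ} {M : ℝ}
    {U : ∀ i, (Fin (K i) → ℝ) → EReal} {A : ∀ i, Matrix (Fin m) (Fin (K i)) ℝ} {b : Fin m → ℝ}
    (hU : ∀ i x, U i x ≠ ⊤)
    (hbox : ∀ x : ∀ i, Fin (K i) → ℝ, (∀ i, 0 ≤ x i) → ∑ i, A i *ᵥ x i ≤ b →
      ∀ i s, x i s ≤ M) :
    primalValue (fun i => boxObjective M (U i)) A b = -utilityValue U A b := by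
  -- Negation distributes over `EReal` sums only away from `⊤ + ⊥`, hence the condition that no
  -- utility is `⊤`.
  have hneg : ∀ (x : ∀ i, Fin (K i) → ℝ) (s : Finset (Fin n)),
      ∑ i ∈ s, -U i (x i) = -∑ i ∈ s, U i (x i) ∧ ∑ i ∈ s, U i (x i) ≠ ⊤ := by
    intro x s
    classical
    induction s using Finset.induction_on with
    | empty => simp
    | insert a s ha ih =>
      rw [Finset.sum_insert ha, Finset.sum_insert ha, ih.1,
        EReal.neg_add (Or.inr ih.2) (Or.inl (hU a (x a)))]
      exact ⟨rfl, (EReal.add_lt_top (hU a _) ih.2).ne⟩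
  apply le_antisymm
  · rw [EReal.le_neg]
    refine iSup₂_le fun x hx => ?_
    rw [EReal.le_neg]
    refine (iInf₂_le x hx.2).trans (le_of_eq ?_)
    rw [← (hneg x Finset.univ).1]
    refine Finset.sum_congr rfl fun i _ => ?_
    exact if_pos fun s => ⟨hx.1 i s, hbox x hx.1 hx.2 i s⟩
  · refine le_iInf₂ fun x hx => ?_
    by_cases h : ∀ i s, 0 ≤ x i s ∧ x i s ≤ M
    · rw [Finset.sum_congr rfl fun i _ => show boxObjective M (U i) (x i) = -U i (x i) from
        if_pos (h i), (hneg x Finset.univ).1, EReal.neg_le_neg_iff]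
      exact le_iSup₂ (f := fun (x : ∀ i, Fin (K i) → ℝ)
        (_ : (∀ i, 0 ≤ x i) ∧ ∑ i, A i *ᵥ x i ≤ b) => ∑ i, U i (x i)) x ⟨fun i s => (h i s).1, hx⟩
    · obtain ⟨i, hi⟩ := not_forall.1 h
      rw [EReal.sum_eq_top (i := i) _ (Finset.mem_univ i) (if_neg hi)]
      · exact le_top
      · intro j _
        change boxObjective M (U j) (x j) ≠ ⊥
        rw [boxObjective]
        split_ifs
        · simpa using hU j (x j)
        · exact top_ne_bot

/-! ### Nonconvexity of the single-path utilities. -/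

section Sup

variable {k : ℕ}

theorem le_ciSup_fin (x : Fin k → ℝ) (s : Fin k) : x s ≤ ⨆ s, x s :=
  le_ciSup (Set.finite_range x).bddAbove s

theorem continuous_ciSup_fin [NeZero k] : Continuous fun x : Fin k → ℝ => ⨆ s, x s := by
  simp_rw [← Finset.sup'_univ_eq_ciSup]
  exact Continuous.finset_sup'_apply _ fun i _ => continuous_apply i

/-- By nonnegativity, the largest entry of each `w x • x` is at most the same entry of the
barycentre; there are `s.card` such terms. -/
theorem sum_mul_ciSup_le_card_mul [NeZero k] {s : Finset (Fin k → ℝ)} {w : (Fin k → ℝ) → ℝ}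
    (hs : ∀ x ∈ s, 0 ≤ x) (hw : ∀ x ∈ s, 0 < w x) :
    ∑ x ∈ s, w x * (⨆ t, x t) ≤ s.card * ⨆ t, (∑ x ∈ s, w x • x) t := by
  rw [← nsmul_eq_mul]
  refine Finset.sum_le_card_nsmul _ _ _ fun x hx => ?_
  obtain ⟨t, ht⟩ := exists_eq_ciSup_of_finite (f := x)
  rw [← ht]
  refine le_trans ?_ (le_ciSup_fin _ t)
  rw [Finset.sum_apply]
  exact Finset.single_le_sum (f := fun z : Fin k → ℝ => (w z • z) t)
    (fun z hz => mul_nonneg (hw z hz).le (hs z hz t)) hx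

/-- The mean `S` of the maxima is at most `M`, and the barycentre retains at least `S / s.card`. -/
theorem throughput_nonconvexity [NeZero k] {M : ℝ} (s : Finset (Fin k → ℝ))
    (w : (Fin k → ℝ) → ℝ) (hs : ∀ x ∈ s, x ∈ Set.Icc 0 (fun _ : Fin k => M))
    (hw : ∀ x ∈ s, 0 < w x) (hw1 : ∑ x ∈ s, w x = 1) :
    -(⨆ t, (∑ x ∈ s, w x • x) t) ≤
      ∑ x ∈ s, w x * -(⨆ t, x t) + (1 - 1 / (s.card : ℝ)) * M := by
  have h1 := sum_mul_ciSup_le_card_mul (fun x hx => (hs x hx).1) hw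
  have hc : 1 ≤ s.card := Finset.card_pos.2 (Finset.nonempty_of_sum_ne_zero (by rw [hw1]; simp))
  have hc' : (1 : ℝ) ≤ s.card := by exact_mod_cast hc
  have h2 : ∑ x ∈ s, w x * (⨆ t, x t) ≤ M := by
    rw [← one_mul M, ← hw1, Finset.sum_mul]
    exact Finset.sum_le_sum fun x hx =>
      mul_le_mul_of_nonneg_left (ciSup_le fun t => (hs x hx).2 t) (hw x hx).le
  have h3 : (∑ x ∈ s, w x * (⨆ t, x t)) / s.card ≤ ⨆ t, (∑ x ∈ s, w x • x) t := by
    rw [div_le_iff₀ (by linarith)]; linarith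
  have h4 : 0 ≤ (1 - 1 / (s.card : ℝ)) * (M - ∑ x ∈ s, w x * (⨆ t, x t)) := by
    refine mul_nonneg ?_ (by linarith)
    rw [sub_nonneg, div_le_one (by linarith)]
    exact hc'
  have h5 : 1 / (s.card : ℝ) * (∑ x ∈ s, w x * (⨆ t, x t)) =
    (∑ x ∈ s, w x * (⨆ t, x t)) / s.card := by ring
  simp only [mul_neg, Finset.sum_neg_distrib]
  nlinarith

/-- Jensen for `log`; the factor `s.card` then becomes an additive `log`. -/
theorem log_nonconvexity [NeZero k] (s : Finset (Fin k → ℝ))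
    (w : (Fin k → ℝ) → ℝ) (hs : ∀ x ∈ s, 0 ≤ x ∧ 0 < ⨆ t, x t)
    (hw : ∀ x ∈ s, 0 < w x) (hw1 : ∑ x ∈ s, w x = 1) :
    -Real.log (⨆ t, (∑ x ∈ s, w x • x) t) ≤
      ∑ x ∈ s, w x * -Real.log (⨆ t, x t) + Real.log s.card := by
  have h1 := sum_mul_ciSup_le_card_mul (fun x hx => (hs x hx).1) hw
  have hne : s.Nonempty := Finset.nonempty_of_sum_ne_zero (by rw [hw1]; simp)
  have hc : 0 < (s.card : ℝ) := by exact_mod_cast Finset.card_pos.2 hne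
  have h2 : 0 < ∑ x ∈ s, w x * (⨆ t, x t) :=
    Finset.sum_pos (fun x hx => mul_pos (hw x hx) (hs x hx).2) hne
  have h3 : 0 < ⨆ t, (∑ x ∈ s, w x • x) t := by
    by_contra! h
    nlinarith
  have h4 : ∑ x ∈ s, w x * Real.log (⨆ t, x t) ≤ Real.log (∑ x ∈ s, w x * (⨆ t, x t)) := by
    simpa using strictConcaveOn_log_Ioi.concaveOn.le_map_sum (t := s) (w := w)
      (p := fun x => ⨆ t, x t) (fun x hx => (hw x hx).le) hw1 (fun x hx => (hs x hx).2)
  have h5 := Real.log_le_log h2 h1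
  rw [Real.log_mul hc.ne' h3.ne'] at h5
  simp only [mul_neg, Finset.sum_neg_distrib]
  linarith

theorem convex_box_inter_pos [NeZero k] {M : ℝ} :
    Convex ℝ {x | x ∈ Set.Icc 0 (fun _ : Fin k => M) ∧ 0 < ⨆ s, x s} := by
  rintro x ⟨hx, hx'⟩ y ⟨hy, hy'⟩ a c ha hc hac
  refine ⟨convex_Icc _ _ hx hy ha hc hac, ?_⟩
  obtain ⟨t, ht⟩ := exists_eq_ciSup_of_finite (f := x)
  obtain ⟨t', ht'⟩ := exists_eq_ciSup_of_finite (f := y)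
  rcases ha.eq_or_lt with h | h
  · have : c = 1 := by linarith
    simpa [← h, this] using hy'
  · refine lt_of_lt_of_le ?_ (le_ciSup_fin _ t)
    have h1 := mul_pos h (ht ▸ hx')
    have h2 := mul_nonneg hc (hy.1 t)
    simp only [Pi.add_apply, Pi.smul_apply, smul_eq_mul]
    linarith

theorem realizedOn_throughput [NeZero k] {M : ℝ} (hM : 0 ≤ M) :
    RealizedOn (boxObjective (k := k) M throughputUtility) (Set.Icc 0 fun _ => M)
      (fun x => -⨆ s, x s) := by
  refine realizedOn_boxObjective ?_ (fun x => ?_) (fun x _ => ?_) ⟨0, le_rfl, fun _ => hM⟩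
    ⟨-M, fun x hx => neg_le_neg (ciSup_le fun s => hx.2 s)⟩
  · exact (continuous_coe_real_ereal.comp continuous_ciSup_fin).continuousOn
  · simp [throughputUtility]
  · simp [throughputUtility]

/-- `ENNReal.log` is continuous even at `0`, which gives continuity where the utility is `⊥`. -/
theorem logUtility_eq (x : Fin k → ℝ) :
    logUtility x = ENNReal.log (ENNReal.ofReal (⨆ s, x s)) := by
  rw [ENNReal.log_ofReal, logUtility]
  by_cases h : 0 < ⨆ s, x s
  · rw [if_pos h, if_neg (not_le.2 h)]
  · rw [if_neg h, if_pos (not_lt.1 h)]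

theorem realizedOn_log [NeZero k] {M : ℝ} (hM : 0 < M) :
    RealizedOn (boxObjective (k := k) M logUtility)
      {x | x ∈ Set.Icc 0 (fun _ : Fin k => M) ∧ 0 < ⨆ s, x s}
      (fun x => -Real.log (⨆ s, x s)) := by
  refine realizedOn_boxObjective ?_ (fun x => ?_) (fun x hx => ?_) ?_
    ⟨-Real.log M, fun x hx => neg_le_neg (Real.log_le_log hx.2 (ciSup_le fun s => hx.1.2 s))⟩
  · refine Continuous.continuousOn ?_
    simp_rw [funext logUtility_eq]
    exact ENNReal.continuous_log.comp (ENNReal.continuous_ofReal.comp continuous_ciSup_fin)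
  · simp only [Set.mem_ofPred_eq, logUtility]
    refine and_congr_right fun _ => ?_
    split_ifs with h <;> simp [h]
  · rw [logUtility, if_pos hx.2, neg_neg]
  · exact ⟨fun _ => M, ⟨fun _ => hM.le, le_rfl⟩, by simpa using hM⟩

end Sup

/-! ### Single-path routing. -/

section Routing

variable {N L : ℕ} {K : Fin N → ℕ}

theorem routingMatrix_mulVec {k : ℕ} (path : Fin k → Finset (Fin L)) (x : Fin k → ℝ) (l : Fin L) :
    (routingMatrix path *ᵥ x) l = ∑ s, if l ∈ path s then x s else 0 := by
  simp [routingMatrix, Matrix.mulVec, dotProduct]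

theorem le_norm_of_routing {c : Fin L → ℝ} {path : ∀ i, Fin (K i) → Finset (Fin L)}
    (hpath : ∀ i s, (path i s).Nonempty) {x : ∀ i, Fin (K i) → ℝ} (hx : ∀ i, 0 ≤ x i)
    (hxc : ∑ i, routingMatrix (path i) *ᵥ x i ≤ c) (i : Fin N) (s : Fin (K i)) :
    x i s ≤ ‖c‖ := by
  obtain ⟨l, hl⟩ := hpath i s
  have hnn : ∀ i s, 0 ≤ if l ∈ path i s then x i s else 0 := fun i s => by
    split_ifs
    · exact hx i s
    · exact le_rfl
  calc x i s = if l ∈ path i s then x i s else 0 := by rw [if_pos hl]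
    _ ≤ ∑ s, if l ∈ path i s then x i s else 0 :=
        Finset.single_le_sum (f := fun s => if l ∈ path i s then x i s else 0)
          (fun s _ => hnn i s) (Finset.mem_univ s)
    _ ≤ ∑ i, ∑ s, if l ∈ path i s then x i s else 0 :=
        Finset.single_le_sum (f := fun i => ∑ s, if l ∈ path i s then x i s else 0)
          (fun i _ => Finset.sum_nonneg fun s _ => hnn i s) (Finset.mem_univ i)
    _ = (∑ i, routingMatrix (path i) *ᵥ x i) l := by
        simp only [Finset.sum_apply, routingMatrix_mulVec]
    _ ≤ c l := hxc l
    _ ≤ ‖c l‖ := Real.le_norm_self _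
    _ ≤ ‖c‖ := norm_le_pi_norm c l

theorem exists_pos_feasible_routing [NeZero L] {c : Fin L → ℝ} (hc : ∀ l, 0 < c l)
    (path : ∀ i, Fin (K i) → Finset (Fin L)) :
    ∃ ε : ℝ, 0 < ε ∧ ε ≤ ‖c‖ ∧
      ∑ i, routingMatrix (path i) *ᵥ (fun _ : Fin (K i) => ε) ≤ c := by
  obtain ⟨l₀, hl₀⟩ := Finite.exists_min c
  have hS : (0 : ℝ) ≤ ∑ i, (K i : ℝ) := Finset.sum_nonneg fun i _ => Nat.cast_nonneg _
  have hε : 0 < c l₀ / (∑ i, (K i : ℝ) + 1) := div_pos (hc l₀) (by linarith)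
  have hεle : (∑ i, (K i : ℝ) + 1) * (c l₀ / (∑ i, (K i : ℝ) + 1)) = c l₀ :=
    mul_div_cancel₀ _ (by linarith)
  have hcn : c l₀ ≤ ‖c‖ := (Real.le_norm_self _).trans (norm_le_pi_norm c l₀)
  -- The same small flow on every path: a link carries at most `∑ i, K i` of them. Positivity is
  -- needed for the logarithm.
  refine ⟨c l₀ / (∑ i, (K i : ℝ) + 1), hε, by nlinarith, fun l => ?_⟩
  rw [Finset.sum_apply]
  have h1 : ∑ i, (routingMatrix (path i) *ᵥ
      (fun _ : Fin (K i) => c l₀ / (∑ i, (K i : ℝ) + 1))) l ≤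
      ∑ i, (K i : ℝ) * (c l₀ / (∑ i, (K i : ℝ) + 1)) := by
    refine Finset.sum_le_sum fun i _ => ?_
    rw [routingMatrix_mulVec]
    refine (Finset.sum_le_card_nsmul _ _ (c l₀ / (∑ i, (K i : ℝ) + 1)) fun s _ => ?_).trans ?_
    · split_ifs
      · exact le_rfl
      · exact hε.le
    · simp
  rw [← Finset.sum_mul] at h1
  linarith [hl₀ l]

theorem throughput_gap (hN : 1 ≤ N) (hL : 1 ≤ L) {c : Fin L → ℝ} (hc : ∀ l, 0 < c l)
    (hK : ∀ i, 1 ≤ K i) (path : ∀ i, Fin (K i) → Finset (Fin L)) :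
    ∃ p d : ℝ,
      primalValue (fun i => boxObjective (k := K i) ‖c‖ throughputUtility)
        (fun i => routingMatrix (path i)) c = (p : EReal) ∧
      dualValue (fun i => boxObjective (k := K i) ‖c‖ throughputUtility)
        (fun i => routingMatrix (path i)) c = (d : EReal) ∧
      p - d ≤ (min N L : ℕ) * ((L : ℝ) / ((L : ℝ) + (min N L : ℕ))) * ‖c‖ := by
  have hK' : ∀ i, NeZero (K i) := fun i => ⟨by have := hK i; omega⟩
  have hL' : NeZero L := ⟨by omega⟩
  obtain ⟨ε, hε, hεc, hεp⟩ := exists_pos_feasible_routing hc path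
  refine exists_duality_gap_le (fun i => realizedOn_throughput (norm_nonneg c))
    (fun i => convex_Icc _ _) (fun _ k => (1 - 1 / (k : ℝ)) * ‖c‖)
    (fun i s w hs hw hw1 => throughput_nonconvexity s w hs hw hw1) (fun k hk hsum => ?_)
    (x₀ := fun i _ => ε) (fun i => ⟨fun _ => hε.le, fun _ => hεc⟩) hεp
  have hq : (0 : ℝ) < (min N L : ℕ) := by exact_mod_cast (by omega : 0 < min N L)
  have hLr : (0 : ℝ) < L := by exact_mod_cast hL
  set q : ℝ := ((min N L : ℕ) : ℝ) with hqd
  have ha : 0 < 1 + (L : ℝ) / q := by positivity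
  have haB : (L : ℝ) / (L + q) = 1 - 1 / (1 + (L : ℝ) / q) := by field_simp; ring
  rw [mul_assoc, haB]
  -- The slope is the derivative of `(1 - 1/k)‖c‖` at `k = 1 + L/q`.
  refine sum_le_min_mul hN hL (s := ‖c‖ / (1 + (L : ℝ) / q) ^ 2) (by positivity) hk hsum
    (fun i => ?_) fun i hi => by simp [hi]
  have hki : (0 : ℝ) < k i := by exact_mod_cast hk i
  rw [← hqd]
  set a : ℝ := 1 + (L : ℝ) / q
  have h1 : 1 / a - 1 / (k i : ℝ) ≤ (k i - a) / a ^ 2 := by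
    rw [div_sub_div _ _ ha.ne' hki.ne', div_le_div_iff₀ (by positivity) (by positivity)]
    nlinarith [mul_nonneg ha.le (sq_nonneg ((k i : ℝ) - a))]
  have h2 := mul_le_mul_of_nonneg_left h1 (norm_nonneg c)
  have h3 : ‖c‖ / a ^ 2 * (k i - a) = ‖c‖ * ((k i - a) / a ^ 2) := by ring
  rw [h3]
  linarith

theorem log_le_log_add_div {a k : ℝ} (ha : 0 < a) (hk : 0 < k) :
    Real.log k ≤ Real.log a + 1 / a * (k - a) := by
  have h := Real.log_le_sub_one_of_pos (div_pos hk ha)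
  rw [Real.log_div hk.ne' ha.ne'] at h
  have : 1 / a * (k - a) = k / a - 1 := by field_simp
  linarith

theorem log_gap (hN : 1 ≤ N) (hL : 1 ≤ L) {c : Fin L → ℝ} (hc : ∀ l, 0 < c l)
    (hK : ∀ i, 1 ≤ K i) (path : ∀ i, Fin (K i) → Finset (Fin L)) :
    ∃ p d : ℝ,
      primalValue (fun i => boxObjective (k := K i) ‖c‖ logUtility)
        (fun i => routingMatrix (path i)) c = (p : EReal) ∧
      dualValue (fun i => boxObjective (k := K i) ‖c‖ logUtility)
        (fun i => routingMatrix (path i)) c = (d : EReal) ∧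
      p - d ≤ (min N L : ℕ) * Real.log (1 + (L : ℝ) / (min N L : ℕ)) := by
  have hK' : ∀ i, NeZero (K i) := fun i => ⟨by have := hK i; omega⟩
  have hL' : NeZero L := ⟨by omega⟩
  obtain ⟨ε, hε, hεc, hεp⟩ := exists_pos_feasible_routing hc path
  refine exists_duality_gap_le (fun i => realizedOn_log (hε.trans_le hεc))
    (fun i => convex_box_inter_pos) (fun _ k => Real.log k)
    (fun i s w hs hw hw1 => log_nonconvexity s w (fun x hx => ⟨(hs x hx).1.1, (hs x hx).2⟩) hw hw1)
    (fun k hk hsum => ?_) (x₀ := fun i _ => ε)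
    (fun i => ⟨⟨fun _ => hε.le, fun _ => hεc⟩, by simpa using hε⟩) hεp
  have ha : 0 < 1 + (L : ℝ) / (min N L : ℕ) := by positivity
  exact sum_le_min_mul hN hL (s := 1 / (1 + (L : ℝ) / (min N L : ℕ))) (by positivity) hk hsum
    (fun i => log_le_log_add_div ha (by exact_mod_cast hk i)) fun i hi => by simp [hi]

end Routing

/-! ### Dynamic spectrum management. -/

section Spectrum

variable {L : ℕ} {σ : ℝ} {x : Fin L → ℝ}

/-- The total rate on one tone in natural units, for nonnegative powers. -/
noncomputable def toneLogSum (σ : ℝ) (x : Fin L → ℝ) : ℝ :=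
  ∑ l, Real.log (1 + x l / (∑ j, x j - x l + σ))

theorem sum_toneRate (N : ℕ) (hx : 0 ≤ x) :
    ∑ l, toneRate N σ x l = 1 / (N : ℝ) * toneLogSum σ x := by
  have h : ∑ j, |x j| = ∑ j, x j := Finset.sum_congr rfl fun j _ => abs_of_nonneg (hx j)
  simp only [toneRate, toneLogSum, h, ← Finset.mul_sum]

theorem interference_pos (hσ : 0 < σ) (hx : 0 ≤ x) (l : Fin L) : 0 < ∑ j, x j - x l + σ := by
  have := Finset.single_le_sum (fun j _ => hx j) (Finset.mem_univ l)
  linarith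

theorem toneLogSum_nonneg (hσ : 0 < σ) (hx : 0 ≤ x) : 0 ≤ toneLogSum σ x :=
  Finset.sum_nonneg fun l _ => Real.log_nonneg (by
    have := div_nonneg (hx l) (interference_pos hσ hx l).le
    simp only at this
    linarith)

/-- From `log t ≥ 1 - 1/t`, each user contributes at least its share `x l / (∑ j, x j + σ)`. -/
theorem le_toneLogSum (hσ : 0 < σ) (hx : 0 ≤ x) :
    1 - σ / (∑ j, x j + σ) ≤ toneLogSum σ x := by
  have hS : 0 ≤ ∑ j, x j := Finset.sum_nonneg fun j _ => hx j
  have h1 : 1 - σ / (∑ j, x j + σ) = ∑ l, x l / (∑ j, x j + σ) := by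
    rw [← Finset.sum_div]
    field_simp
    ring
  rw [h1]
  refine Finset.sum_le_sum fun l _ => ?_
  have hv := interference_pos hσ hx l
  have hxl : 0 ≤ x l := hx l
  have h2 : 0 < 1 + x l / (∑ j, x j - x l + σ) := by positivity
  refine le_trans (le_of_eq ?_) (Real.one_sub_inv_le_log_of_pos h2)
  have h3 : ∑ j, x j + σ = (∑ j, x j - x l + σ) + x l := by ring
  rw [h3]
  generalize ∑ j, x j - x l + σ = v at hv h2
  field_simp
  ring

/-- Add users one at a time, keeping only interference from those already added: the bounds
telescope. -/
theorem toneLogSum_le_log (hσ : 0 < σ) (hx : 0 ≤ x) :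
    toneLogSum σ x ≤ Real.log (∑ j, x j + σ) - Real.log σ := by
  have key : ∀ T : Finset (Fin L), ∑ l ∈ T, Real.log (1 + x l / (∑ j, x j - x l + σ)) ≤
      Real.log (∑ j ∈ T, x j + σ) - Real.log σ := by
    intro T
    induction T using Finset.induction_on with
    | empty => simp
    | insert a T ha ih =>
      rw [Finset.sum_insert ha, Finset.sum_insert ha]
      have hxa : 0 ≤ x a := hx a
      have hT : 0 ≤ ∑ j ∈ T, x j := Finset.sum_nonneg fun j _ => hx j
      have h1 : x a + ∑ j ∈ T, x j ≤ ∑ j, x j := by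
        rw [← Finset.sum_insert ha]
        exact Finset.sum_le_sum_of_subset_of_nonneg (Finset.subset_univ _) fun j _ _ => hx j
      have h2 : Real.log (1 + x a / (∑ j, x j - x a + σ)) ≤
          Real.log ((x a + ∑ j ∈ T, x j + σ) / (∑ j ∈ T, x j + σ)) := by
        have hv := interference_pos hσ hx a
        refine Real.log_le_log (by positivity) ?_
        have h3 : (x a + ∑ j ∈ T, x j + σ) / (∑ j ∈ T, x j + σ) =
            1 + x a / (∑ j ∈ T, x j + σ) := by
          field_simp
          ring
        rw [h3]
        gcongr
        linarith
      rw [Real.log_div (by positivity) (by positivity)] at h2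
      linarith
  exact key Finset.univ

/-- For total power plus noise at most `2`, use the logarithmic bound. Otherwise `log (1 + t) ≤ t`
and `x l ≤ 1` give at most `2 - σ ≤ 1 - log σ`. -/
theorem toneLogSum_le_one_sub_log (hσ : 0 < σ) (hσ1 : σ ≤ 1) (hx : 0 ≤ x) (hx1 : x ≤ 1) :
    toneLogSum σ x ≤ 1 - Real.log σ := by
  have hS : 0 ≤ ∑ j, x j := Finset.sum_nonneg fun j _ => hx j
  rcases le_total (∑ j, x j + σ) 2 with h | h
  · have h1 := toneLogSum_le_log hσ hx
    have h2 := Real.log_le_sub_one_of_pos (show 0 < ∑ j, x j + σ by linarith)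
    linarith
  · have hv : 0 < ∑ j, x j - 1 + σ := by linarith
    have h1 : toneLogSum σ x ≤ ∑ l, x l / (∑ j, x j - 1 + σ) := by
      refine Finset.sum_le_sum fun l _ => ?_
      have hxl : 0 ≤ x l := hx l
      have hxl1 : x l ≤ 1 := hx1 l
      have hvl := interference_pos hσ hx l
      have h2 := Real.log_le_sub_one_of_pos
        (show 0 < 1 + x l / (∑ j, x j - x l + σ) by positivity)
      have h3 : x l / (∑ j, x j - x l + σ) ≤ x l / (∑ j, x j - 1 + σ) := by gcongr
      linarith
    rw [← Finset.sum_div] at h1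
    have h2 := Real.log_le_sub_one_of_pos hσ
    have h3 : (∑ j, x j) / (∑ j, x j - 1 + σ) ≤ 2 - σ := by
      rw [div_le_iff₀ hv]
      nlinarith
    linarith

/-- The loss does not depend on the number of points. At low mean power, Jensen on the logarithmic
bound suffices; at high mean power the barycentre still achieves `1/2`, and `1 - 1/2 ≤ log 2`. -/
theorem toneLogSum_nonconvexity (hσ : 0 < σ) (hσ1 : σ ≤ 1) (s : Finset (Fin L → ℝ))
    (w : (Fin L → ℝ) → ℝ) (hs : ∀ x ∈ s, x ∈ Set.Icc (0 : Fin L → ℝ) 1)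
    (hw : ∀ x ∈ s, 0 < w x) (hw1 : ∑ x ∈ s, w x = 1) :
    ∑ x ∈ s, w x * toneLogSum σ x ≤ toneLogSum σ (∑ x ∈ s, w x • x) + Real.log (2 / σ) := by
  have hne : s.Nonempty := Finset.nonempty_of_sum_ne_zero (by rw [hw1]; simp)
  have hy : 0 ≤ ∑ x ∈ s, w x • x := Finset.sum_nonneg fun x hx =>
    smul_nonneg (hw x hx).le (hs x hx).1
  rw [Real.log_div two_ne_zero hσ.ne']
  rcases le_total (∑ l, (∑ x ∈ s, w x • x) l + σ) 2 with h | h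
  · have hSx : ∀ x ∈ s, 0 < ∑ j, x j + σ := fun x hx =>
      add_pos_of_nonneg_of_pos (Finset.sum_nonneg fun j _ => (hs x hx).1 j) hσ
    have h1 : ∑ x ∈ s, w x * toneLogSum σ x ≤
        ∑ x ∈ s, w x * (Real.log (∑ j, x j + σ) - Real.log σ) :=
      Finset.sum_le_sum fun x hx =>
        mul_le_mul_of_nonneg_left (toneLogSum_le_log hσ (hs x hx).1) (hw x hx).le
    have h2 : ∑ x ∈ s, w x * Real.log (∑ j, x j + σ) ≤
        Real.log (∑ x ∈ s, w x * (∑ j, x j + σ)) := by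
      simpa using strictConcaveOn_log_Ioi.concaveOn.le_map_sum (t := s) (w := w)
        (p := fun x => ∑ j, x j + σ) (fun x hx => (hw x hx).le) hw1 hSx
    have h3 : ∑ x ∈ s, w x * (∑ j, x j + σ) = ∑ l, (∑ x ∈ s, w x • x) l + σ := by
      simp only [mul_add, Finset.sum_add_distrib, ← Finset.sum_mul, hw1, one_mul,
        Finset.sum_apply, Pi.smul_apply, smul_eq_mul, Finset.mul_sum]
      rw [Finset.sum_comm]
    have h4 : Real.log (∑ l, (∑ x ∈ s, w x • x) l + σ) ≤ Real.log 2 := by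
      refine Real.log_le_log ?_ h
      rw [← h3]
      exact Finset.sum_pos (fun x hx => mul_pos (hw x hx) (hSx x hx)) hne
    have h5 := toneLogSum_nonneg hσ hy
    simp only [mul_sub, Finset.sum_sub_distrib, ← Finset.sum_mul, hw1, one_mul] at h1
    rw [h3] at h2
    linarith
  · have h1 : ∑ x ∈ s, w x * toneLogSum σ x ≤ ∑ x ∈ s, w x * (1 - Real.log σ) :=
      Finset.sum_le_sum fun x hx => mul_le_mul_of_nonneg_left
        (toneLogSum_le_one_sub_log hσ hσ1 (hs x hx).1 (hs x hx).2) (hw x hx).le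
    rw [← Finset.sum_mul, hw1, one_mul] at h1
    have h2 := le_toneLogSum hσ hy
    have h3 : σ / (∑ l, (∑ x ∈ s, w x • x) l + σ) ≤ 1 / 2 := by
      rw [div_le_div_iff₀ (by linarith) two_pos]
      linarith
    linarith [Real.log_two_gt_d9]

/-- Bound on the nonconvexity of one tone for combinations of `k` power vectors. -/
noncomputable def toneNonconvexity (N : ℕ) (σ : ℝ) (k : ℕ) : ℝ :=
  if k = 1 then 0 else 1 / (N : ℝ) * Real.log (k / σ)

theorem tone_nonconvexity (N : ℕ) (hσ : 0 < σ) (hσ1 : σ ≤ 1) (s : Finset (Fin L → ℝ))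
    (w : (Fin L → ℝ) → ℝ) (hs : ∀ x ∈ s, x ∈ Set.Icc (0 : Fin L → ℝ) 1)
    (hw : ∀ x ∈ s, 0 < w x) (hw1 : ∑ x ∈ s, w x = 1) :
    -∑ l, toneRate N σ (∑ x ∈ s, w x • x) l ≤
      ∑ x ∈ s, w x * -∑ l, toneRate N σ x l + toneNonconvexity N σ s.card := by
  have hne : s.Nonempty := Finset.nonempty_of_sum_ne_zero (by rw [hw1]; simp)
  rw [toneNonconvexity]
  split_ifs with h
  · obtain ⟨x, rfl⟩ := Finset.card_eq_one.1 h
    rw [Finset.sum_singleton] at hw1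
    simp [hw1]
  · have hy : 0 ≤ ∑ x ∈ s, w x • x := Finset.sum_nonneg fun x hx =>
      smul_nonneg (hw x hx).le (hs x hx).1
    have h1 : ∑ x ∈ s, w x * -∑ l, toneRate N σ x l =
        -(1 / (N : ℝ) * ∑ x ∈ s, w x * toneLogSum σ x) := by
      rw [Finset.mul_sum, ← Finset.sum_neg_distrib]
      refine Finset.sum_congr rfl fun x hx => ?_
      rw [sum_toneRate N (hs x hx).1]
      ring
    rw [h1, sum_toneRate N hy]
    -- Weakened to a loss concave in the number of points, the form in which the tangent-line count
    -- yields the stated constant.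
    have h2 : Real.log (2 / σ) ≤ Real.log (s.card / σ) := by
      refine Real.log_le_log (by positivity) ?_
      have h3 : 2 ≤ s.card := by
        have := Finset.card_pos.2 hne
        omega
      gcongr
      exact_mod_cast h3
    have h4 := mul_le_mul_of_nonneg_left
      ((toneLogSum_nonconvexity hσ hσ1 s w hs hw hw1).trans (add_le_add_right h2 _))
      (show 0 ≤ 1 / (N : ℝ) by positivity)
    linarith

theorem continuousOn_toneThroughput (N : ℕ) (hσ : 0 < σ) :
    ContinuousOn (toneThroughput (L := L) N σ) {x | 0 ≤ x} := by
  refine continuous_coe_real_ereal.comp_continuousOn ?_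
  refine continuousOn_finsetSum _ fun l _ => ?_
  unfold toneRate
  have hpos : ∀ x ∈ {x : Fin L → ℝ | 0 ≤ x}, 0 < ∑ j, |x j| - x l + σ := by
    intro x hx
    have := Finset.single_le_sum (fun j _ => abs_nonneg (x j)) (Finset.mem_univ l)
    linarith [le_abs_self (x l)]
  refine ContinuousOn.mul continuousOn_const (ContinuousOn.log ?_ fun x hx => ?_)
  · refine ContinuousOn.add continuousOn_const (ContinuousOn.div ?_ ?_ fun x hx => (hpos x hx).ne')
    · fun_prop
    · fun_prop
  · have h1 : 0 ≤ x l := hx l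
    have h2 := hpos x hx
    positivity

theorem realizedOn_toneThroughput (N : ℕ) (hσ : 0 < σ) (hσ1 : σ ≤ 1) :
    RealizedOn (boxObjective (k := L) 1 (toneThroughput N σ)) (Set.Icc 0 1)
      (fun x => -∑ l, toneRate N σ x l) := by
  refine realizedOn_boxObjective
    ((continuousOn_toneThroughput N hσ).mono fun x hx => hx.1) (fun x => ?_) (fun x _ => ?_)
    ⟨0, le_rfl, fun _ => zero_le_one⟩ ⟨-(1 / (N : ℝ) * (1 - Real.log σ)), fun x hx => ?_⟩
  · rw [toneThroughput]
    exact (and_iff_left (EReal.coe_ne_bot _)).symm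
  · rw [toneThroughput, neg_neg]
  · rw [sum_toneRate N hx.1]
    exact neg_le_neg (mul_le_mul_of_nonneg_left
      (toneLogSum_le_one_sub_log hσ hσ1 hx.1 hx.2) (by positivity))

theorem spectrum_gap {N : ℕ} (hN : 1 ≤ N) (hL : 1 ≤ L) {σ : Fin N → ℝ}
    (hσ : ∀ i, 0 < σ i ∧ σ i ≤ 1) {P : Fin L → ℝ} (hP : ∀ l, 0 ≤ P l) :
    ∃ p d : ℝ,
      primalValue (K := fun _ => L) (fun i => boxObjective 1 (toneThroughput N (σ i)))
        (fun _ => 1) P = (p : EReal) ∧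
      dualValue (K := fun _ => L) (fun i => boxObjective 1 (toneThroughput N (σ i)))
        (fun _ => 1) P = (d : EReal) ∧
      p - d ≤ ((min N L : ℕ) : ℝ) / N *
        Real.log ((1 + (L : ℝ) / (min N L : ℕ)) / ⨅ i, σ i) := by
  have hN' : NeZero N := ⟨by omega⟩
  refine exists_duality_gap_le (K := fun _ : Fin N => L) (D := fun _ => Set.Icc 0 1)
    (fun i => realizedOn_toneThroughput N (hσ i).1 (hσ i).2) (fun i => convex_Icc _ _)
    (fun i => toneNonconvexity N (σ i))
    (fun i s w hs hw hw1 => tone_nonconvexity N (hσ i).1 (hσ i).2 s w hs hw hw1)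
    (fun k hk hsum => ?_) (x₀ := fun _ => 0) (fun i => ⟨le_rfl, zero_le_one⟩) (by simpa using (show 0 ≤ P from hP))
  have ha : 0 < 1 + (L : ℝ) / (min N L : ℕ) := by positivity
  obtain ⟨i₀, hi₀⟩ := exists_eq_ciInf_of_finite (f := σ)
  have hσle : ∀ i, σ i₀ ≤ σ i := fun i => hi₀ ▸ ciInf_le (Set.finite_range σ).bddBelow i
  rw [← hi₀]
  have hs0 := (hσ i₀).1
  have hgoal := sum_le_min_mul (B := 1 / (N : ℝ) *
      Real.log ((1 + (L : ℝ) / (min N L : ℕ)) / σ i₀)) hN hL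
    (s := 1 / (N : ℝ) * (1 / (1 + (L : ℝ) / (min N L : ℕ)))) (by positivity) hk hsum
    (r := fun i => toneNonconvexity N (σ i) (k i)) (fun i => ?_)
    (fun i hi => by simp [toneNonconvexity, hi])
  · refine hgoal.trans (le_of_eq ?_)
    ring
  · have hki : (0 : ℝ) < k i := by exact_mod_cast hk i
    have hNr : (0 : ℝ) ≤ 1 / (N : ℝ) := by positivity
    -- Noise at most `1` keeps the logarithmic majorant nonnegative at `k = 1`, where the loss is
    -- set to zero.
    have hlogσ : Real.log (σ i) ≤ 0 := Real.log_nonpos (hσ i).1.le (hσ i).2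
    have h1 : toneNonconvexity N (σ i) (k i) ≤ 1 / (N : ℝ) * (Real.log (k i) - Real.log (σ i)) := by
      rw [toneNonconvexity]
      split_ifs with h
      · refine mul_nonneg hNr ?_
        simp [h, hlogσ]
      · rw [Real.log_div hki.ne' (hσ i).1.ne']
    have h2 := log_le_log_add_div ha hki
    have h3 := Real.log_le_log hs0 (hσle i)
    refine h1.trans ?_
    rw [mul_assoc, ← mul_add, Real.log_div ha.ne' hs0.ne']
    exact mul_le_mul_of_nonneg_left (by linarith) hNr

theorem spectrum_powers_le {N : ℕ} {P : Fin L → ℝ} (hP : ∀ l, P l ≤ 1) {x : Fin N → Fin L → ℝ}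
    (hx : ∀ i, 0 ≤ x i) (hxP : ∑ i, (1 : Matrix (Fin L) (Fin L) ℝ) *ᵥ x i ≤ P) (i : Fin N)
    (l : Fin L) : x i l ≤ 1 := by
  have h1 := hxP l
  simp only [Matrix.one_mulVec, Finset.sum_apply] at h1
  exact (Finset.single_le_sum (f := fun i => x i l) (fun i _ => hx i l)
    (Finset.mem_univ i)).trans (h1.trans (hP l))

end Spectrum

/-! ### Assembly of the three applications. -/

theorem mainTheorem9 (N L : ℕ) (hN : 1 ≤ N) (hL : 1 ≤ L) :
    -- single-path routing: `N` users, `L` links with capacities `c`, `‖c‖` is the sup norm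
    (∀ (c : Fin L → ℝ), (∀ l, 0 < c l) →
      ∀ (K : Fin N → ℕ), (∀ i, 1 ≤ K i) →
      ∀ (path : ∀ i, Fin (K i) → Finset (Fin L)),
        -- throughput utility
        (∃ p d : ℝ,
          primalValue (fun i => boxObjective (k := K i) ‖c‖ throughputUtility)
            (fun i => routingMatrix (path i)) c = (p : EReal) ∧
          dualValue (fun i => boxObjective (k := K i) ‖c‖ throughputUtility)
            (fun i => routingMatrix (path i)) c = (d : EReal) ∧
          p - d ≤ (min N L : ℕ) * ((L : ℝ) / ((L : ℝ) + (min N L : ℕ))) * ‖c‖) ∧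
        -- logarithmic utility
        (∃ p d : ℝ,
          primalValue (fun i => boxObjective (k := K i) ‖c‖ logUtility)
            (fun i => routingMatrix (path i)) c = (p : EReal) ∧
          dualValue (fun i => boxObjective (k := K i) ‖c‖ logUtility)
            (fun i => routingMatrix (path i)) c = (d : EReal) ∧
          p - d ≤ (min N L : ℕ) * Real.log (1 + (L : ℝ) / (min N L : ℕ))) ∧
        -- if every path passes through a link, these are the utility maximisation problems
        ((∀ i s, (path i s).Nonempty) →
          primalValue (fun i => boxObjective (k := K i) ‖c‖ throughputUtility)
              (fun i => routingMatrix (path i)) c =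
            -utilityValue (fun i => throughputUtility (k := K i))
              (fun i => routingMatrix (path i)) c ∧
          primalValue (fun i => boxObjective (k := K i) ‖c‖ logUtility)
              (fun i => routingMatrix (path i)) c =
            -utilityValue (fun i => logUtility (k := K i))
              (fun i => routingMatrix (path i)) c)) ∧
    -- dynamic spectrum management: `L` users, `N` tones, noises `σ i`, power budgets `P l`
    (∀ (σ : Fin N → ℝ), (∀ i, 0 < σ i ∧ σ i ≤ 1) →
      ∀ (P : Fin L → ℝ), (∀ l, 0 ≤ P l ∧ P l ≤ 1) →
        (∃ p d : ℝ,
          primalValue (K := fun _ => L) (fun i => boxObjective 1 (toneThroughput N (σ i)))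
            (fun _ => 1) P = (p : EReal) ∧
          dualValue (K := fun _ => L) (fun i => boxObjective 1 (toneThroughput N (σ i)))
            (fun _ => 1) P = (d : EReal) ∧
          p - d ≤ ((min N L : ℕ) : ℝ) / N *
            Real.log ((1 + (L : ℝ) / (min N L : ℕ)) / ⨅ i, σ i)) ∧
        primalValue (K := fun _ => L) (fun i => boxObjective 1 (toneThroughput N (σ i)))
            (fun _ => 1) P =
          -utilityValue (K := fun _ => L) (fun i => toneThroughput N (σ i)) (fun _ => 1) P) := by
  refine ⟨fun c hc K hK path => ⟨throughput_gap hN hL hc hK path, log_gap hN hL hc hK path,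
    fun hpath => ⟨?_, ?_⟩⟩, fun σ hσ P hP => ⟨spectrum_gap hN hL hσ fun l => (hP l).1, ?_⟩⟩
  · exact primalValue_boxObjective_eq_neg (U := fun i => throughputUtility (k := K i))
      (fun i x => EReal.coe_ne_top _) fun x hx hxc => le_norm_of_routing hpath hx hxc
  · refine primalValue_boxObjective_eq_neg (U := fun i => logUtility (k := K i))
      (fun i x => ?_) fun x hx hxc => le_norm_of_routing hpath hx hxc
    rw [logUtility]
    split_ifs
    · exact EReal.coe_ne_top _
    · exact bot_ne_top
  · exact primalValue_boxObjective_eq_neg (K := fun _ : Fin N => L)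
      (U := fun i => toneThroughput N (σ i)) (fun i x => EReal.coe_ne_top _)
      fun x hx hxP => spectrum_powers_le (fun l => (hP l).2) hx hxP
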